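/- Work in a fixed countably saturated nonstandard universe (transfer holds, and every sequence of internal sets with the finite intersection property has nonempty intersection), with ${}^*\mathbb N$ the set of hyperintegers and $\mathbb N\subseteq{}^*\mathbb N$. A set is *Borel* if it belongs to the least $\sigma$-algebra (of subsets of ${}^*\mathbb N$, or of ${}^*\mathbb N\times{}^*\mathbb N$) containing all internal sets. A set $X$ is *countably determined* (CD) if $$X=\bigcup_{b\in B}\Bigl(\bigcap_{m\in b}X_m\cap\bigcap_{m\notin b}\Bigl(\bigcup_n X_n\setminus X_m\Bigr)\Bigr)$$ for some sequence of internal sets $X_m$ $(m\in\mathbb N)$ and some $B\subseteq\mathcal P(\mathbb N)$. For $X,Y\subseteq{}^*\mathbb N$ write $X\le_{CD}Y$ if there is an injection $X\to Y$ whose graph is a CD subset of ${}^*\mathbb N\times{}^*\mathbb N$; write $X\equiv_{CD}Y$ if $X\le_{CD}Y$ and $Y\le_{CD}X$, and $X<_{CD}Y$ if $X\le_{CD}Y$ but not $Y\le_{CD}X$. A *cut* is an initial segment $U\subseteq{}^*\mathbb N$; it is *additive* if $x+y\in U$ for all $x,y\in U$. For $c\in{}^*\mathbb N$ put $$c/\mathbb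 N=\{x\in{}^*\mathbb N: nx\le c\text{ for all }n\in\mathbb N,\ n\ge 1\},\qquad c\,\mathbb N=\{x\in{}^*\mathbb N: x\le cn\text{ for some }n\in\mathbb N\}.$$ Call $c\in{}^*\mathbb N$ *infinitely large* if $c\notin\mathbb N$. **Theorem.** Let $X\subseteq{}^*\mathbb N$ be an infinite CD set. Then either there is a unique additive Borel cut $U$ with $U\equiv_{CD}X$, or there is an infinitely large $c\in{}^*\mathbb N$ such that $c/\mathbb N<_{CD}X<_{CD}c\,\mathbb N$. -/

import Mathlib

open Set

/-- The types of the finite type hierarchy over `ℕ` (the typed form of the superstructure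
over `ℕ`): `ℕ` itself, products, and power sets. -/
class inductive StandardType : Type → Prop
  | nat : StandardType ℕ
  | prod {α β : Type} : StandardType α → StandardType β → StandardType (α × β)
  | set {α : Type} : StandardType α → StandardType (Set α)

instance StandardType.instNat : StandardType ℕ := StandardType.nat

instance StandardType.instProd {α β : Type} [hα : StandardType α] [hβ : StandardType β] :
    StandardType (α × β) := StandardType.prod hα hβ

instance StandardType.instSet {α : Type} [hα : StandardType α] : StandardType (Set α) :=
  StandardType.set hα

universe u

/-- A nonstandard universe over the finite type hierarchy on `ℕ`. Every standard type `α` has a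
nonstandard extension `Hyper α` (the internal objects of type `α`), every function `f` an
extension `map f`, and every set `A` (in particular, every relation) an extension `starSet A`.

The last group of laws is the transfer principle: the passage `A ↦ starSet A` commutes with
negation, conjunction, substitution (inverse images under arbitrary functions) and existential
quantification (images, in particular projections), hence with every first-order construction
over these types, the membership relations `a ∈ A` between `α` and `Set α` included. (Equality is
transferred as well, the diagonal being the image of `x ↦ (x, x)`.) -/
structure NonstandardUniverse where
  Hyper : (α : Type) → [StandardType α] → Type u
  std : {α : Type} → [StandardType α] → α → Hyper α
  map : {α β : Type} → [StandardType α] → [StandardType β] → (α → β) → Hyper α → Hyper β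
  starSet : {α : Type} → [StandardType α] → Set α → Set (Hyper α)
  map_id : ∀ {α : Type} [StandardType α] (x : Hyper α), map (id : α → α) x = x
  map_comp : ∀ {α β γ : Type} [StandardType α] [StandardType β] [StandardType γ]
    (g : β → γ) (f : α → β) (x : Hyper α), map (g ∘ f) x = map g (map f x)
  /-- An internal pair is the same thing as a pair of internal objects. -/
  prod_bijective : ∀ {α β : Type} [StandardType α] [StandardType β],
    Function.Bijective
      (fun p : Hyper (α × β) =>
        ((map (Prod.fst : α × β → α) p, map (Prod.snd : α × β → β) p) : Hyper α × Hyper β))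
  starSet_singleton : ∀ {α : Type} [StandardType α] (a : α), starSet {a} = {std a}
  starSet_compl : ∀ {α : Type} [StandardType α] (A : Set α), starSet Aᶜ = (starSet A)ᶜ
  starSet_inter : ∀ {α : Type} [StandardType α] (A B : Set α),
    starSet (A ∩ B) = starSet A ∩ starSet B
  starSet_preimage : ∀ {α β : Type} [StandardType α] [StandardType β] (f : α → β) (B : Set β),
    starSet (f ⁻¹' B) = map f ⁻¹' starSet B
  starSet_image : ∀ {α β : Type} [StandardType α] [StandardType β] (f : α → β) (A : Set α),
    starSet (f '' A) = map f '' starSet A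

namespace NonstandardUniverse

variable (U : NonstandardUniverse.{u})

section General

variable {α β : Type} [StandardType α] [StandardType β]

/-- The internal pair with given components. -/
noncomputable def pair (x : U.Hyper α) (y : U.Hyper β) : U.Hyper (α × β) :=
  (Equiv.ofBijective _ (U.prod_bijective (α := α) (β := β))).symm (x, y)

/-- The set of elements of an internal object of type `Set α`, given by the nonstandard extension
of the membership relation. -/
def ext (A : U.Hyper (Set α)) : Set (U.Hyper α) :=
  {x | U.pair x A ∈ U.starSet {p : α × Set α | p.1 ∈ p.2}}

/-- Internal subsets of `Hyper α`. -/
def IsInternal (X : Set (U.Hyper α)) : Prop :=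
  ∃ A : U.Hyper (Set α), X = U.ext A

/-- Borel sets: the least `σ`-algebra containing the internal sets. -/
def IsBorel (X : Set (U.Hyper α)) : Prop :=
  @MeasurableSet (U.Hyper α)
    (MeasurableSpace.generateFrom {Y : Set (U.Hyper α) | U.IsInternal Y}) X

/-- Countably determined sets. -/
def IsCD (X : Set (U.Hyper α)) : Prop :=
  ∃ (A : ℕ → Set (U.Hyper α)) (B : Set (Set ℕ)), (∀ m, U.IsInternal (A m)) ∧
    X = ⋃ b ∈ B, ((⋂ m ∈ b, A m) ∩ ⋂ m ∈ bᶜ, ((⋃ n, A n) \ A m))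

end General

/-- Countable saturation: a sequence of internal sets with the finite intersection property has
nonempty intersection. -/
def CountablySaturated : Prop :=
  ∀ (α : Type) [StandardType α] (A : ℕ → Set (U.Hyper α)),
    (∀ n, U.IsInternal (A n)) → (∀ s : Finset ℕ, (⋂ n ∈ s, A n).Nonempty) →
      (⋂ n, A n).Nonempty

/-! Order and arithmetic of the hyperintegers `U.Hyper ℕ`. -/

instance : LE (U.Hyper ℕ) :=
  ⟨fun x y => U.pair x y ∈ U.starSet {p : ℕ × ℕ | p.1 ≤ p.2}⟩

noncomputable instance : Add (U.Hyper ℕ) :=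
  ⟨fun x y => U.map (fun p : ℕ × ℕ => p.1 + p.2) (U.pair x y)⟩

noncomputable instance : Mul (U.Hyper ℕ) :=
  ⟨fun x y => U.map (fun p : ℕ × ℕ => p.1 * p.2) (U.pair x y)⟩

/-- Infinitely large hyperintegers: those not in `ℕ`. -/
def IsInfinitelyLarge (c : U.Hyper ℕ) : Prop :=
  ∀ n : ℕ, c ≠ U.std n

/-- Cuts: initial segments of the hyperintegers. -/
def IsCut (C : Set (U.Hyper ℕ)) : Prop :=
  ∀ x ∈ C, ∀ y : U.Hyper ℕ, y ≤ x → y ∈ C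

/-- Additive cuts. -/
def IsAdditiveCut (C : Set (U.Hyper ℕ)) : Prop :=
  U.IsCut C ∧ ∀ x ∈ C, ∀ y ∈ C, x + y ∈ C

/-- The cut `c/ℕ`, the intersection of the segments `[0, c/n]` over positive `n ∈ ℕ`. -/
def divNat (c : U.Hyper ℕ) : Set (U.Hyper ℕ) :=
  {x | ∀ n : ℕ, 0 < n → U.std n * x ≤ c}

/-- The cut `cℕ`, the union of the segments `[0, cn]` over `n ∈ ℕ`. -/
def mulNat (c : U.Hyper ℕ) : Set (U.Hyper ℕ) :=
  {x | ∃ n : ℕ, x ≤ c * U.std n}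

/-- The graph of the restriction of `f` to `X`, as a set of internal pairs. -/
def graphOn (X : Set (U.Hyper ℕ)) (f : U.Hyper ℕ → U.Hyper ℕ) : Set (U.Hyper (ℕ × ℕ)) :=
  {p | ∃ x ∈ X, p = U.pair x (f x)}

/-- `X ≤_CD Y`: there is an injection of `X` into `Y` whose graph is countably determined. -/
def CDLe (X Y : Set (U.Hyper ℕ)) : Prop :=
  ∃ f : U.Hyper ℕ → U.Hyper ℕ, MapsTo f X Y ∧ InjOn f X ∧ U.IsCD (U.graphOn X f)

/-- `X ≡_CD Y`. -/
def CDEquiv (X Y : Set (U.Hyper ℕ)) : Prop :=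
  U.CDLe X Y ∧ U.CDLe Y X

/-- `X <_CD Y`. -/
def CDLt (X Y : Set (U.Hyper ℕ)) : Prop :=
  U.CDLe X Y ∧ ¬ U.CDLe Y X

end NonstandardUniverse

/-! The inner cut `I` of `X` consists of the hyperintegers less than the internal cardinality of
some internal subset of `X`. For `c ∈ I` the segment `[0, c]` reduces to `X`. For `c ∉ I`,
saturation covers `X` by countably many internal sets of cardinality at most `c`, and stacking the
corresponding segments of length `c` gives `X ≤_CD c ℕ`.

If `I` is not additive, say `x, y ∈ I` and `x + y ∉ I`, then `c = x + y` satisfies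
`c/ℕ ≤_CD X ≤_CD c ℕ`. If `I` is additive, there are two cases.
* `I` is the cut of sizes below all members of a decreasing sequence of internal sets whose
  intersection lies in `X`. Saturation reduces `I` to `X`. Either `c/ℕ ⊆ I` for some `c ∉ I`, and
  then `c/ℕ ≤_CD X ≤_CD c ℕ`; or one can descend to `I` by a sequence `D` with `D (n + 1)` in
  `D n/ℕ`, and then `X` lies in a single internal set of each cardinality `D n`, so that `X`
  reduces to `I`.
* `X` is covered by internal sets whose cardinalities are bounded by elements `e n` of `I`. If the
  `e n` are bounded by some `c ∈ I`, then again `c/ℕ ≤_CD X ≤_CD c ℕ`; if they are cofinal in `I`,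
  stacking segments of length `e n` reduces `X` to `I`, and packing internal subsets of `X` reduces
  `I` to `X`.

When `c/ℕ ≤_CD X ≤_CD c ℕ` and one of the two reductions is reversible, the additive cut `c/ℕ` or
`c ℕ` is equivalent to `X`. Uniqueness is a counting argument: an injection with CD graph is
covered by countably many internal injections, of which the `k`-th takes values at most
`d / 2 ^ (k + 2)` at no more than about `d / 2 ^ (k + 2)` points; so `[0, d)` does not reduce to
`d/ℕ` for infinitely large `d`. -/

open Filter

lemma exists_injOn_of_lt_encard {α : Type*} [Nonempty α] (W : ℕ → Set α) :
    ∃ f : ℕ → α, InjOn f {y : ℕ | (y : ℕ∞) < (W y).encard} ∧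
      ∀ y : ℕ, (y : ℕ∞) < (W y).encard → f y ∈ W y := by
  classical
  let T : Set ℕ := {y : ℕ | (y : ℕ∞) < (W y).encard}
  have hsub (y : T) : ∃ s : Finset α, ↑s ⊆ W y ∧ s.card = y + 1 := by
    obtain ⟨s, hs, hcard⟩ := exists_subset_encard_eq (k := (y : ℕ) + 1) (Order.add_one_le_of_lt y.2)
    have hfin : s.Finite := finite_of_encard_eq_coe (k := y + 1) (by exact_mod_cast hcard)
    lift s to Finset α using hfin
    exact ⟨s, hs, by rw [encard_coe_eq_coe_finsetCard] at hcard; exact_mod_cast hcard⟩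
  choose s hsW hcard using hsub
  have hall (I : Finset T) : I.card ≤ (I.biUnion s).card := by
    obtain rfl | hI := I.eq_empty_or_nonempty
    · exact zero_le
    calc I.card = (I.map (.subtype _)).card := (I.card_map _).symm
      _ ≤ (Finset.range (I.max' hI + 1)).card := Finset.card_le_card fun y hy => by
          obtain ⟨z, hz, rfl⟩ := Finset.mem_map.1 hy
          exact Finset.mem_range_succ_iff.2 (I.le_max' z hz)
      _ = (s (I.max' hI)).card := by rw [Finset.card_range, hcard]
      _ ≤ (I.biUnion s).card :=
        Finset.card_le_card (Finset.subset_biUnion_of_mem s (I.max'_mem hI))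
  obtain ⟨f, hf, hfs⟩ := (Finset.all_card_le_biUnion_card_iff_exists_injective s).1 hall
  refine ⟨fun y => if hy : y ∈ T then f ⟨y, hy⟩ else Classical.arbitrary α, ?_, fun y hy => ?_⟩
  · intro x (hx : x ∈ T) y (hy : y ∈ T) hxy
    simp only [hx, hy, dif_pos] at hxy
    exact congrArg Subtype.val (hf hxy)
  · simp only [show y ∈ T from hy, ↓reduceDIte]
    exact hsW ⟨y, hy⟩ (hfs ⟨y, hy⟩)

lemma exists_enumeration_of_chain {α ι : Type*} [Nonempty α] [Finite ι] (Z : ι → Set α)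
    (hZ : ∀ i j, Z i ⊆ Z j ∨ Z j ⊆ Z i) :
    ∃ f : ℕ → α, InjOn f {y : ℕ | ∃ i, (y : ℕ∞) < (Z i).encard} ∧
      ∀ i, MapsTo f {y : ℕ | (y : ℕ∞) < (Z i).encard} (Z i) := by
  let W (y : ℕ) : Set α := {x | ∀ i, (y : ℕ∞) < (Z i).encard → x ∈ Z i}
  have hW (y : ℕ) (hy : ∃ i, (y : ℕ∞) < (Z i).encard) : (y : ℕ∞) < (W y).encard := by
    obtain ⟨i, hi⟩ := (toFinite {i | (y : ℕ∞) < (Z i).encard}).exists_minimalFor Z _ hy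
    refine hi.1.trans_le (encard_le_encard fun x hx j hj => ?_)
    exact (hZ i j).elim (fun h => h hx) fun h => hi.2 hj h hx
  obtain ⟨f, hf, hfW⟩ := exists_injOn_of_lt_encard W
  exact ⟨f, hf.mono hW, fun i y hy => hfW y (hW y ⟨i, hy⟩) i hy⟩

lemma surjOn_of_injOn_setOf_lt_encard {α : Type*} {S : Set α} (hS : S.Finite) {f : ℕ → α}
    (hinj : InjOn f {y : ℕ | (y : ℕ∞) < S.encard})
    (hmaps : MapsTo f {y : ℕ | (y : ℕ∞) < S.encard} S) :
    SurjOn f {y : ℕ | (y : ℕ∞) < S.encard} S := by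
  have hIio : {y : ℕ | (y : ℕ∞) < S.encard} = Iio S.ncard := by
    ext y
    rw [mem_ofPred_eq, ← hS.cast_ncard_eq, Nat.cast_lt, mem_Iio]
  rw [hIio] at hinj hmaps ⊢
  refine (eq_of_subset_of_ncard_le hmaps.image_subset ?_ hS).symm.subset
  rw [hinj.ncard_image, ← Finset.coe_Iio, ncard_coe_finset, Nat.card_Iio]

lemma exists_ranking_of_chain {α ι : Type*} [Nonempty α] [Finite ι] (Z : ι → Set α)
    (hZ : ∀ i j, Z i ⊆ Z j ∨ Z j ⊆ Z i) (d : ι → ℕ) (hd : ∀ i, (Z i).encard ≤ d i) :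
    ∃ g : α → ℕ, ∀ i, InjOn g (Z i) ∧ MapsTo g (Z i) (Iio (d i)) := by
  obtain ⟨f, hf, hfZ⟩ := exists_enumeration_of_chain Z hZ
  let T : Set ℕ := {y : ℕ | ∃ i, (y : ℕ∞) < (Z i).encard}
  have hT (i : ι) : {y : ℕ | (y : ℕ∞) < (Z i).encard} ⊆ T := fun _ hy => ⟨i, hy⟩
  have hsurj (i : ι) : SurjOn f {y : ℕ | (y : ℕ∞) < (Z i).encard} (Z i) :=
    surjOn_of_injOn_setOf_lt_encard (finite_of_encard_le_coe (hd i)) (hf.mono (hT i)) (hfZ i)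
  refine ⟨Function.invFunOn f T, fun i => ⟨?_, fun x hx => ?_⟩⟩
  · exact (Function.invFunOn_injOn_image f T).mono ((hsurj i).trans (image_mono (hT i)))
  · obtain ⟨y, hy, rfl⟩ := hsurj i hx
    rw [hf.leftInvOn_invFunOn (hT i hy)]
    exact Nat.cast_lt.1 (lt_of_lt_of_le hy (hd i))

lemma card_filter_le_of_injOn_snd {α : Type*} {F : Set (α × ℕ)} (hF : InjOn Prod.snd F)
    (s : Finset α) (m : ℕ) [DecidablePred fun x => ∃ y ≤ m, (x, y) ∈ F] :
    {x ∈ s | ∃ y ≤ m, (x, y) ∈ F}.card ≤ m + 1 := by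
  have hex : ∀ x ∈ {x ∈ s | ∃ y ≤ m, (x, y) ∈ F}, ∃ y ≤ m, (x, y) ∈ F :=
    fun x hx => (Finset.mem_filter.1 hx).2
  choose! g hgm hgF using hex
  rw [← Finset.card_range (m + 1)]
  exact Finset.card_le_card_of_injOn g (fun x hx => Finset.mem_range_succ_iff.2 (hgm x hx))
    fun x hx x' hx' h => congrArg Prod.fst (hF (hgF x hx) (hgF x' hx') h)

/-- The `k`-th injection takes at most `D / 2 ^ (k + 2) + 1` points to values
`≤ D / 2 ^ (k + 2)`, which makes fewer than `D` points altogether. -/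
lemma exists_lt_forall_lt_two_pow_mul {F : ℕ → Set (ℕ × ℕ)} {n D : ℕ}
    (hF : ∀ k < n, InjOn Prod.snd (F k)) (hD : 2 * n < D) :
    ∃ x < D, ∀ k < n, ∀ y, (x, y) ∈ F k → D < 2 ^ (k + 2) * y := by
  classical
  by_contra! hcover
  let m (k : ℕ) : ℕ := D / 4 / 2 ^ k
  have hm (k y : ℕ) (h : 2 ^ (k + 2) * y ≤ D) : y ≤ m k := by
    change y ≤ D / 4 / 2 ^ k
    rw [Nat.div_div_eq_div_mul, Nat.le_div_iff_mul_le (by positivity)]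
    exact le_of_eq_of_le (by ring) h
  let Q (k : ℕ) : Finset ℕ := {x ∈ Finset.range D | ∃ y ≤ m k, (x, y) ∈ F k}
  have hsub : Finset.range D ⊆ (Finset.range n).biUnion Q := fun x hx => by
    obtain ⟨k, hk, y, hy, hle⟩ := hcover x (Finset.mem_range.1 hx)
    exact Finset.mem_biUnion.2
      ⟨k, Finset.mem_range.2 hk, Finset.mem_filter.2 ⟨hx, y, hm k y hle, hy⟩⟩
  have hcard : D ≤ ∑ k ∈ Finset.range n, m k + n := calc
    D = (Finset.range D).card := (Finset.card_range D).symm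
    _ ≤ ∑ k ∈ Finset.range n, (Q k).card := (Finset.card_le_card hsub).trans Finset.card_biUnion_le
    _ ≤ ∑ k ∈ Finset.range n, (m k + 1) := Finset.sum_le_sum fun k hk =>
      card_filter_le_of_injOn_snd (hF k (Finset.mem_range.1 hk)) _ _
    _ = ∑ k ∈ Finset.range n, m k + n := by
      rw [Finset.sum_add_distrib, Finset.sum_const, Finset.card_range, smul_eq_mul, mul_one]
  have hsum : ∑ k ∈ Finset.range n, m k ≤ D / 4 * 2 / (2 - 1) := Nat.geom_sum_le le_rfl _ _
  omega

instance StandardType.instNonempty {α : Type} [h : StandardType α] : Nonempty α := by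
  induction h with
  | nat => exact ⟨0⟩
  | prod _ _ ihα ihβ => exact ihα.map2 Prod.mk ihβ
  | set => exact ⟨∅⟩

namespace NonstandardUniverse

variable {U : NonstandardUniverse.{u}}

section Transfer

variable {α β γ δ : Type} [StandardType α] [StandardType β] [StandardType γ] [StandardType δ]

variable (U) in
lemma starSet_empty : U.starSet (∅ : Set α) = ∅ := by
  have h := U.starSet_inter (∅ : Set α) ∅ᶜ
  rwa [U.starSet_compl, inter_compl_self, inter_compl_self] at h

variable (U) in
lemma starSet_univ : U.starSet (univ : Set α) = univ := by
  rw [← compl_empty, U.starSet_compl, U.starSet_empty, compl_empty]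

variable (U) in
lemma starSet_mono {A B : Set α} (h : A ⊆ B) : U.starSet A ⊆ U.starSet B := by
  rw [← inter_eq_left.2 h, U.starSet_inter]
  exact inter_subset_right

variable (U) in
/-- The ultrafilter of standard sets whose extension contains the internal object `p`. An internal
object behaves like a generic point of this ultrafilter: a statement about values `U.map f p` of
standard functions holds if and only if it holds for the values `f t` at eventually all `t`. -/
def ult (p : U.Hyper γ) : Ultrafilter γ :=
  Ultrafilter.ofComplNotMemIff
    { sets := {A | p ∈ U.starSet A}
      univ_sets := by simp only [U.starSet_univ, mem_ofPred_eq, mem_univ]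
      sets_of_superset := fun hA h => U.starSet_mono h hA
      inter_sets := fun hA hB => by
        simp only [mem_ofPred_eq, U.starSet_inter]
        exact ⟨hA, hB⟩ }
    (fun A => by
      change p ∉ U.starSet Aᶜ ↔ p ∈ U.starSet A
      rw [U.starSet_compl, mem_compl_iff, not_not])

lemma map_mem_starSet {p : U.Hyper γ} {f : γ → α} {A : Set α} :
    U.map f p ∈ U.starSet A ↔ ∀ᶠ t in U.ult p, f t ∈ A := by
  change p ∈ U.map f ⁻¹' U.starSet A ↔ _
  rw [← U.starSet_preimage]
  rfl

lemma map_id' (p : U.Hyper γ) : U.map (fun t => t) p = p := U.map_id p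

lemma map_map {g : α → β} {f : γ → α} {p : U.Hyper γ} :
    U.map g (U.map f p) = U.map (fun t => g (f t)) p :=
  (U.map_comp g f p).symm

lemma eventually_ult_map {f : γ → α} {p : U.Hyper γ} {φ : α → Prop} :
    (∀ᶠ t in U.ult (U.map f p), φ t) ↔ ∀ᶠ t in U.ult p, φ (f t) :=
  map_mem_starSet (A := {t | φ t})

lemma map_fst_snd_pair (x : U.Hyper α) (y : U.Hyper β) :
    (U.map Prod.fst (U.pair x y), U.map Prod.snd (U.pair x y)) = (x, y) :=
  (Equiv.ofBijective _ (U.prod_bijective (α := α) (β := β))).apply_symm_apply (x, y)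

@[simp] lemma map_fst_pair (x : U.Hyper α) (y : U.Hyper β) : U.map Prod.fst (U.pair x y) = x :=
  congrArg Prod.fst (map_fst_snd_pair x y)

@[simp] lemma map_snd_pair (x : U.Hyper α) (y : U.Hyper β) : U.map Prod.snd (U.pair x y) = y :=
  congrArg Prod.snd (map_fst_snd_pair x y)

lemma prod_ext {p q : U.Hyper (α × β)} (h₁ : U.map Prod.fst p = U.map Prod.fst q)
    (h₂ : U.map Prod.snd p = U.map Prod.snd q) : p = q :=
  U.prod_bijective.1 (Prod.ext h₁ h₂)

lemma exists_pair_eq (p : U.Hyper (α × β)) : ∃ x y, U.pair x y = p :=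
  ⟨_, _, prod_ext (map_fst_pair (U.map Prod.fst p) (U.map Prod.snd p)) (map_snd_pair _ _)⟩

@[simp] lemma pair_inj {x x' : U.Hyper α} {y y' : U.Hyper β} :
    U.pair x y = U.pair x' y' ↔ x = x' ∧ y = y' := by
  refine ⟨fun h => ⟨?_, ?_⟩, fun ⟨h₁, h₂⟩ => h₁ ▸ h₂ ▸ rfl⟩
  · simpa using congrArg (U.map Prod.fst) h
  · simpa using congrArg (U.map Prod.snd) h

lemma pair_map {f : γ → α} {g : γ → β} {p : U.Hyper γ} :
    U.pair (U.map f p) (U.map g p) = U.map (fun t => (f t, g t)) p :=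
  prod_ext (by simp only [map_fst_pair, map_map]) (by simp only [map_snd_pair, map_map])

@[elab_as_elim]
lemma map_induction {motive : U.Hyper α → Prop}
    (map : ∀ {γ : Type} [StandardType γ] (p : U.Hyper γ) (f : γ → α), motive (U.map f p))
    (x : U.Hyper α) : motive x :=
  map_id' x ▸ map x fun t => t

@[elab_as_elim]
lemma map_induction₂ {motive : U.Hyper α → U.Hyper β → Prop}
    (map : ∀ {γ : Type} [StandardType γ] (p : U.Hyper γ) (f : γ → α) (g : γ → β),
      motive (U.map f p) (U.map g p))
    (x : U.Hyper α) (y : U.Hyper β) : motive x y := by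
  simpa using map (U.pair x y) Prod.fst Prod.snd

@[elab_as_elim]
lemma map_induction₃ {motive : U.Hyper α → U.Hyper β → U.Hyper δ → Prop}
    (map : ∀ {γ : Type} [StandardType γ] (p : U.Hyper γ) (f : γ → α) (g : γ → β) (h : γ → δ),
      motive (U.map f p) (U.map g p) (U.map h p))
    (x : U.Hyper α) (y : U.Hyper β) (z : U.Hyper δ) : motive x y z := by
  simpa only [U.map_comp, map_fst_pair, map_snd_pair] using
    map (U.pair x (U.pair y z)) Prod.fst (Prod.fst ∘ Prod.snd) (Prod.snd ∘ Prod.snd)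

lemma map_eq_map {f g : γ → α} {p : U.Hyper γ} :
    U.map f p = U.map g p ↔ ∀ᶠ t in U.ult p, f t = g t := by
  have hdiag : U.pair (U.map f p) (U.map g p) ∈ U.starSet ((fun a : α => (a, a)) '' univ) ↔
      ∀ᶠ t in U.ult p, f t = g t := by
    rw [pair_map, map_mem_starSet]
    simp only [image_univ, mem_range, Prod.mk.injEq, exists_eq_left]
  rw [← hdiag, U.starSet_image, U.starSet_univ]
  have hpair (q : U.Hyper α) : U.map (fun a : α => (a, a)) q = U.pair q q := by
    nth_rw 2 3 [← map_id' q]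
    rw [pair_map]
  simp only [image_univ, mem_range, hpair, pair_inj, exists_eq_left]

lemma std_eq_map (a : α) (p : U.Hyper γ) : U.std a = U.map (fun _ => a) p := by
  have h : U.map (fun _ => a) p ∈ U.starSet ({a} : Set α) :=
    map_mem_starSet.2 (Eventually.of_forall fun _ => rfl)
  rw [U.starSet_singleton] at h
  exact h.symm

lemma map_mem_ext {p : U.Hyper γ} {f : γ → α} {F : γ → Set α} :
    U.map f p ∈ U.ext (U.map F p) ↔ ∀ᶠ t in U.ult p, f t ∈ F t := by
  change U.pair (U.map f p) (U.map F p) ∈ U.starSet {p : α × Set α | p.1 ∈ p.2} ↔ _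
  rw [pair_map, map_mem_starSet]
  rfl

lemma ext_map_subset {p : U.Hyper γ} {F G : γ → Set α} :
    U.ext (U.map F p) ⊆ U.ext (U.map G p) ↔ ∀ᶠ t in U.ult p, F t ⊆ G t := by
  constructor
  · intro h
    by_contra hnot
    obtain ⟨f, hf⟩ : ∃ f : γ → α, ∀ᶠ t in U.ult p, f t ∈ F t ∧ f t ∉ G t :=
      ((Ultrafilter.eventually_not.2 hnot).mono fun t => not_subset.1).choice
    have hfG := map_mem_ext.1 (h (map_mem_ext.2 (hf.mono fun t ht => ht.1)))
    obtain ⟨t, hG, hFG⟩ := (hfG.and hf).exists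
    exact hFG.2 hG
  · intro h x
    induction p, x using map_induction₂ with
    | map p q f =>
      simp only [map_map, map_mem_ext, eventually_ult_map] at h ⊢
      exact fun hf => h.mp (hf.mono fun t ht hs => hs ht)

end Transfer

section Order

variable {γ : Type} [StandardType γ]

lemma map_add_map {p : U.Hyper γ} {f g : γ → ℕ} :
    U.map f p + U.map g p = U.map (fun t => f t + g t) p := by
  change U.map _ (U.pair _ _) = _
  rw [pair_map, map_map]

lemma map_mul_map {p : U.Hyper γ} {f g : γ → ℕ} :
    U.map f p * U.map g p = U.map (fun t => f t * g t) p := by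
  change U.map _ (U.pair _ _) = _
  rw [pair_map, map_map]

lemma map_le_map {p : U.Hyper γ} {f g : γ → ℕ} :
    U.map f p ≤ U.map g p ↔ ∀ᶠ t in U.ult p, f t ≤ g t := by
  change U.pair _ _ ∈ _ ↔ _
  rw [pair_map, map_mem_starSet]
  rfl

noncomputable instance : LinearOrder (U.Hyper ℕ) where
  le_refl x := by
    rw [← map_id' x, map_le_map]
    exact Eventually.of_forall fun _ => le_rfl
  le_trans x y z := by
    induction x, y, z using map_induction₃ with
    | map p f g h =>
      simp only [map_le_map]
      exact fun hfg hgh => hfg.mp (hgh.mono fun t h₂ h₁ => h₁.trans h₂)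
  le_antisymm x y := by
    induction x, y using map_induction₂ with
    | map p f g =>
      simp only [map_le_map, map_eq_map]
      exact fun hfg hgf => hfg.mp (hgf.mono fun t h₂ h₁ => h₁.antisymm h₂)
  le_total x y := by
    induction x, y using map_induction₂ with
    | map p f g =>
      simp only [map_le_map, ← Ultrafilter.eventually_or]
      exact Eventually.of_forall fun t => le_total _ _
  toDecidableLE := Classical.decRel _

lemma map_lt_map {p : U.Hyper γ} {f g : γ → ℕ} :
    U.map f p < U.map g p ↔ ∀ᶠ t in U.ult p, f t < g t := by
  simp_rw [← not_le, map_le_map, Ultrafilter.eventually_not]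

instance : Zero (U.Hyper ℕ) := ⟨U.std 0⟩

lemma map_zero (p : U.Hyper γ) : U.map (fun _ => 0) p = (0 : U.Hyper ℕ) := (std_eq_map 0 p).symm

instance : One (U.Hyper ℕ) := ⟨U.std 1⟩

noncomputable instance : CommSemiring (U.Hyper ℕ) where
  natCast := U.std
  nsmul := nsmulRec
  natCast_zero := rfl
  natCast_succ n := by
    obtain ⟨p⟩ : Nonempty (U.Hyper ℕ) := ⟨0⟩
    change U.std (n + 1) = U.std n + U.std 1
    simp only [std_eq_map _ p, map_add_map]
  add_assoc x y z := by
    induction x, y, z using map_induction₃ with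
    | map => simp only [map_add_map, add_assoc]
  add_comm x y := by
    induction x, y using map_induction₂ with
    | map => simp only [map_add_map, add_comm]
  zero_add x := by
    induction x using map_induction with
    | map p f =>
      change U.std 0 + U.map f p = U.map f p
      simp only [std_eq_map _ p, map_add_map, zero_add]
  add_zero x := by
    induction x using map_induction with
    | map p f =>
      change U.map f p + U.std 0 = U.map f p
      simp only [std_eq_map _ p, map_add_map, add_zero]
  mul_assoc x y z := by
    induction x, y, z using map_induction₃ with
    | map => simp only [map_mul_map, mul_assoc]
  mul_comm x y := by
    induction x, y using map_induction₂ with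
    | map => simp only [map_mul_map, mul_comm]
  zero_mul x := by
    induction x using map_induction with
    | map p f =>
      change U.std 0 * U.map f p = U.std 0
      simp only [std_eq_map _ p, map_mul_map, zero_mul]
  mul_zero x := by
    induction x using map_induction with
    | map p f =>
      change U.map f p * U.std 0 = U.std 0
      simp only [std_eq_map _ p, map_mul_map, mul_zero]
  one_mul x := by
    induction x using map_induction with
    | map p f =>
      change U.std 1 * U.map f p = U.map f p
      simp only [std_eq_map _ p, map_mul_map, one_mul]
  mul_one x := by
    induction x using map_induction with
    | map p f =>
      change U.map f p * U.std 1 = U.map f p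
      simp only [std_eq_map _ p, map_mul_map, mul_one]
  left_distrib x y z := by
    induction x, y, z using map_induction₃ with
    | map => simp only [map_add_map, map_mul_map, mul_add]
  right_distrib x y z := by
    induction x, y, z using map_induction₃ with
    | map => simp only [map_add_map, map_mul_map, add_mul]

instance : IsStrictOrderedRing (U.Hyper ℕ) where
  add_le_add_left x y hxy z := by
    induction x, y, z using map_induction₃ with
    | map =>
      simp only [map_add_map, map_le_map] at *
      exact hxy.mono fun t ht => by gcongr
  le_of_add_le_add_left x y z := by
    induction x, y, z using map_induction₃ with
    | map => simp only [map_add_map, map_le_map, add_le_add_iff_left, imp_self]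
  zero_le_one := by
    obtain ⟨p⟩ : Nonempty (U.Hyper ℕ) := ⟨0⟩
    change U.std 0 ≤ U.std 1
    simp only [std_eq_map _ p, map_le_map, zero_le, eventually_true]
  exists_pair_ne := ⟨U.std 0, U.std 1, fun h => by
    obtain ⟨p⟩ : Nonempty (U.Hyper ℕ) := ⟨0⟩
    simp only [std_eq_map _ p, map_eq_map, zero_ne_one, eventually_const] at h⟩
  mul_lt_mul_of_pos_left x hx y z hyz := by
    rw [← map_zero x] at hx
    induction x, y, z using map_induction₃ with
    | map =>
      simp only [map_map, map_mul_map, map_lt_map] at *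
      exact hx.mp (hyz.mono fun t hyz hx => by gcongr)
  mul_lt_mul_of_pos_right x hx y z hyz := by
    rw [← map_zero x] at hx
    induction x, y, z using map_induction₃ with
    | map =>
      simp only [map_map, map_mul_map, map_lt_map] at *
      exact hx.mp (hyz.mono fun t hyz hx => by gcongr)

instance : CanonicallyOrderedAdd (U.Hyper ℕ) where
  exists_add_of_le {x y} := by
    induction x, y using map_induction₂ with
    | map p f g =>
      rw [map_le_map]
      refine fun hfg => ⟨U.map (fun t => g t - f t) p, ?_⟩
      rw [map_add_map, map_eq_map]
      exact hfg.mono fun t ht => (Nat.add_sub_cancel' ht).symm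
  le_add_self x y := by
    induction x, y using map_induction₂ with
    | map => simp only [map_add_map, map_le_map, le_add_self, eventually_true]
  le_self_add x y := by
    induction x, y using map_induction₂ with
    | map => simp only [map_add_map, map_le_map, le_self_add, eventually_true]

lemma std_eq_natCast (n : ℕ) : U.std n = (n : U.Hyper ℕ) := rfl

lemma natCast_eq_map (n : ℕ) (p : U.Hyper γ) : (n : U.Hyper ℕ) = U.map (fun _ => n) p :=
  std_eq_map n p

lemma le_natCast_iff {x : U.Hyper ℕ} {n : ℕ} : x ≤ n ↔ ∃ m ≤ n, x = m := by
  induction x using map_induction with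
  | map p f =>
    simp only [natCast_eq_map _ p, map_le_map, map_eq_map]
    simpa only [mem_Iic, exists_eq_right'] using
      Ultrafilter.eventually_exists_mem_iff (finite_Iic n) (P := fun m t => f t = m)

lemma isInfinitelyLarge_iff {c : U.Hyper ℕ} :
    U.IsInfinitelyLarge c ↔ ∀ n : ℕ, (n : U.Hyper ℕ) < c := by
  refine ⟨fun h n => lt_of_not_ge fun hc => ?_, fun h n hn => (h n).ne' hn⟩
  obtain ⟨m, -, rfl⟩ := le_natCast_iff.1 hc
  exact h m rfl

end Order

section InternalSets

variable {α β γ : Type} [StandardType α] [StandardType β] [StandardType γ]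

lemma isInternal_univ : U.IsInternal (univ : Set (U.Hyper α)) := by
  refine ⟨U.std univ, (eq_univ_of_forall fun x => ?_).symm⟩
  induction x using map_induction with
  | map p f => simp only [std_eq_map _ p, map_mem_ext, mem_univ, eventually_true]

lemma isInternal_singleton (x : U.Hyper α) : U.IsInternal {x} := by
  refine ⟨U.map singleton x, Set.ext fun y => ?_⟩
  induction x, y using map_induction₂ with
  | map => simp only [map_map, map_mem_ext, mem_singleton_iff, map_eq_map]

lemma ext_map_compl (A : U.Hyper (Set α)) : U.ext (U.map compl A) = (U.ext A)ᶜ := by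
  ext x
  induction A, x using map_induction₂ with
  | map => simp only [map_map, map_mem_ext, mem_compl_iff, Ultrafilter.eventually_not]

lemma IsInternal.compl {X : Set (U.Hyper α)} (hX : U.IsInternal X) : U.IsInternal Xᶜ := by
  obtain ⟨A, rfl⟩ := hX
  exact ⟨_, (ext_map_compl A).symm⟩

lemma IsInternal.inter {X Y : Set (U.Hyper α)} (hX : U.IsInternal X) (hY : U.IsInternal Y) :
    U.IsInternal (X ∩ Y) := by
  obtain ⟨A, rfl⟩ := hX
  obtain ⟨B, rfl⟩ := hY
  refine ⟨U.map (fun t : Set α × Set α => t.1 ∩ t.2) (U.pair A B), Set.ext fun x => ?_⟩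
  induction A, B, x using map_induction₃ with
  | map => simp only [pair_map, map_map, map_mem_ext, mem_inter_iff, eventually_and]

lemma IsInternal.union {X Y : Set (U.Hyper α)} (hX : U.IsInternal X) (hY : U.IsInternal Y) :
    U.IsInternal (X ∪ Y) := by
  rw [union_eq_compl_compl_inter_compl]
  exact (hX.compl.inter hY.compl).compl

lemma ext_map_preimage (f : α → β) (A : U.Hyper (Set β)) :
    U.ext (U.map (preimage f) A) = U.map f ⁻¹' U.ext A := by
  ext x
  induction A, x using map_induction₂ with
  | map => simp only [map_map, map_mem_ext, mem_preimage]

lemma IsInternal.preimage {Y : Set (U.Hyper β)} (hY : U.IsInternal Y) (f : α → β) :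
    U.IsInternal (U.map f ⁻¹' Y) := by
  obtain ⟨A, rfl⟩ := hY
  exact ⟨_, (ext_map_preimage f A).symm⟩

lemma ext_map_image (f : α → β) (A : U.Hyper (Set α)) :
    U.ext (U.map (image f) A) = U.map f '' U.ext A := by
  ext y
  constructor
  · induction A, y using map_induction₂ with
    | map p F g =>
      simp only [map_map, map_mem_ext]
      intro hg
      obtain ⟨h, hh⟩ := hg.choice
      refine ⟨U.map h p, map_mem_ext.2 (hh.mono fun t ht => ht.1), ?_⟩
      rw [map_map, map_eq_map]
      exact hh.mono fun t ht => ht.2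
  · rintro ⟨x, hx, rfl⟩
    induction A, x using map_induction₂ with
    | map p F g =>
      simp only [map_map, map_mem_ext] at hx ⊢
      exact hx.mono fun t ht => mem_image_of_mem f ht

lemma IsInternal.image {X : Set (U.Hyper α)} (hX : U.IsInternal X) (f : α → β) :
    U.IsInternal (U.map f '' X) := by
  obtain ⟨A, rfl⟩ := hX
  exact ⟨_, (ext_map_image f A).symm⟩

lemma isInternal_setOf_map_eq (f : α → β) (y : U.Hyper β) : U.IsInternal {x | U.map f x = y} :=
  (isInternal_singleton y).preimage f

lemma IsInternal.biInter_lt {X : ℕ → Set (U.Hyper α)} (hX : ∀ n, U.IsInternal (X n)) (n : ℕ) :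
    U.IsInternal (⋂ k < n, X k) := by
  induction n with
  | zero => simpa using isInternal_univ
  | succ n ih =>
    rw [biInter_lt_succ]
    exact ih.inter (hX n)

lemma IsInternal.disjointed {X : ℕ → Set (U.Hyper α)} (hX : ∀ n, U.IsInternal (X n)) (n : ℕ) :
    U.IsInternal (disjointed X n) := by
  rw [disjointed_eq_inter_compl]
  exact (hX n).inter (IsInternal.biInter_lt (fun k => (hX k).compl) n)

lemma IsInternal.dissipate {X : ℕ → Set (U.Hyper α)} (hX : ∀ n, U.IsInternal (X n)) (n : ℕ) :
    U.IsInternal (dissipate X n) := by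
  rw [dissipate_eq_biInter_lt]
  exact IsInternal.biInter_lt hX (n + 1)

lemma IsInternal.accumulate {X : ℕ → Set (U.Hyper α)} (hX : ∀ n, U.IsInternal (X n)) (n : ℕ) :
    U.IsInternal (accumulate X n) := by
  induction n with
  | zero => simpa only [accumulate_zero_nat] using hX 0
  | succ n ih =>
    rw [accumulate_succ]
    exact ih.union (hX (n + 1))

lemma isInternal_of_finite {s : Set (U.Hyper α)} (hs : s.Finite) : U.IsInternal s := by
  induction s, hs using Set.Finite.induction_on with
  | empty => simpa using (isInternal_univ (U := U) (α := α)).compl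
  | insert _ _ ih => exact (isInternal_singleton _).union ih

end InternalSets

section InternalMaps

variable {α β γ : Type} [StandardType α] [StandardType β] [StandardType γ]

/-- The value at `x` of the internal function given by a standard family `h` of functions and an
internal parameter `c`. -/
noncomputable def app (h : γ → α → β) (c : U.Hyper γ) (x : U.Hyper α) : U.Hyper β :=
  U.map (fun t : γ × α => h t.1 t.2) (U.pair c x)

lemma app_map {δ : Type} [StandardType δ] {h : γ → α → β} {g : δ → γ} {f : δ → α} {p : U.Hyper δ} :
    app h (U.map g p) (U.map f p) = U.map (fun t => h (g t) (f t)) p := by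
  rw [app, pair_map, map_map]

/-- A map between internal objects is internal if its graph is an internal set. -/
def IsInternalMap (f : U.Hyper α → U.Hyper β) : Prop :=
  U.IsInternal {p : U.Hyper (α × β) | U.map Prod.snd p = f (U.map Prod.fst p)}

lemma isInternalMap_app (h : γ → α → β) (c : U.Hyper γ) : IsInternalMap (app h c) := by
  refine ⟨U.map (fun c => {q : α × β | q.2 = h c q.1}) c, Set.ext fun p => ?_⟩
  induction c, p using map_induction₂ with
  | map =>
    simp only [mem_ofPred_eq, map_map, app_map, map_eq_map, map_mem_ext]

lemma isInternalMap_id : IsInternalMap fun x : U.Hyper α => x := by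
  obtain ⟨c⟩ : Nonempty (U.Hyper ℕ) := ⟨0⟩
  have hid : app (fun _ x => x) c = fun x : U.Hyper α => x := funext fun x => map_snd_pair c x
  exact hid ▸ isInternalMap_app _ _

lemma image_inter_preimage_eq_comp (R : Set (U.Hyper (α × β))) (S : Set (U.Hyper (β × γ))) :
    U.map (fun t : α × β × γ => (t.1, t.2.2)) ''
        (U.map (fun t : α × β × γ => (t.1, t.2.1)) ⁻¹' R ∩ U.map Prod.snd ⁻¹' S) =
      {p | ∃ y, U.pair (U.map Prod.fst p) y ∈ R ∧ U.pair y (U.map Prod.snd p) ∈ S} := by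
  have htriple (x : U.Hyper α) (y : U.Hyper β) (z : U.Hyper γ) :
      U.map (fun t : α × β × γ => (t.1, t.2.1)) (U.pair x (U.pair y z)) = U.pair x y ∧
      U.map (fun t : α × β × γ => (t.1, t.2.2)) (U.pair x (U.pair y z)) = U.pair x z := by
    induction x, y, z using map_induction₃ with
    | map => simp only [pair_map, map_map, and_self]
  ext p
  obtain ⟨x, z, rfl⟩ := exists_pair_eq p
  simp only [mem_image, mem_inter_iff, mem_preimage, mem_ofPred_eq, map_fst_pair, map_snd_pair]
  constructor
  · rintro ⟨q, hq, hqp⟩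
    obtain ⟨x', q, rfl⟩ := exists_pair_eq q
    obtain ⟨y, z', rfl⟩ := exists_pair_eq q
    simp only [htriple, map_snd_pair, pair_inj] at hq hqp
    obtain ⟨rfl, rfl⟩ := hqp
    exact ⟨y, hq⟩
  · rintro ⟨y, hR, hS⟩
    exact ⟨U.pair x (U.pair y z), by simpa only [htriple, map_snd_pair] using ⟨hR, hS⟩,
      (htriple x y z).2⟩

lemma IsInternal.comp {R : Set (U.Hyper (α × β))} {S : Set (U.Hyper (β × γ))}
    (hR : U.IsInternal R) (hS : U.IsInternal S) :
    U.IsInternal {p | ∃ y, U.pair (U.map Prod.fst p) y ∈ R ∧ U.pair y (U.map Prod.snd p) ∈ S} :=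
  image_inter_preimage_eq_comp R S ▸ ((hR.preimage _).inter (hS.preimage _)).image _

lemma IsInternalMap.comp {g : U.Hyper β → U.Hyper γ} {f : U.Hyper α → U.Hyper β}
    (hg : IsInternalMap g) (hf : IsInternalMap f) : IsInternalMap fun x => g (f x) := by
  have h := IsInternal.comp hf hg
  simp only [mem_ofPred_eq, map_fst_pair, map_snd_pair, exists_eq_left] at h
  exact h

lemma IsInternalMap.const_add {f : U.Hyper α → U.Hyper ℕ} (hf : IsInternalMap f) (d : U.Hyper ℕ) :
    IsInternalMap fun x => d + f x :=
  (isInternalMap_app (fun d x => d + x) d).comp hf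

end InternalMaps

section Saturation

variable {α β γ δ : Type} [StandardType α] [StandardType β] [StandardType γ] [StandardType δ]

lemma CountablySaturated.exists_forall_mem (hU : U.CountablySaturated)
    {X : ℕ → Set (U.Hyper α)} (hX : ∀ n, U.IsInternal (X n))
    (h : ∀ n, ∃ x, ∀ k < n, x ∈ X k) : ∃ x, ∀ n, x ∈ X n := by
  obtain ⟨x, hx⟩ := hU α X hX fun s => by
    obtain ⟨x, hx⟩ := h (s.sup id + 1)
    exact ⟨x, mem_iInter₂.2 fun n hn => hx n (Nat.lt_succ_of_le (Finset.le_sup (f := id) hn))⟩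
  exact ⟨x, mem_iInter.1 hx⟩

lemma CountablySaturated.nonempty_iInter_of_antitone (hU : U.CountablySaturated)
    {X : ℕ → Set (U.Hyper α)} (hX : ∀ n, U.IsInternal (X n)) (hanti : Antitone X)
    (hne : ∀ n, (X n).Nonempty) : (⋂ n, X n).Nonempty := by
  obtain ⟨x, hx⟩ := hU.exists_forall_mem hX fun n =>
    (hne n).imp fun x hx k hk => hanti hk.le hx
  exact ⟨x, mem_iInter.2 hx⟩

lemma CountablySaturated.exists_forall_eventually (hU : U.CountablySaturated) (p : U.Hyper γ)
    (φ : ℕ → γ → δ → Prop) (h : ∀ n, ∀ᶠ t in U.ult p, ∃ d, ∀ k < n, φ k t d) :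
    ∃ q : U.Hyper (γ × δ), U.map Prod.fst q = p ∧
      ∀ n, ∀ᶠ t : γ × δ in U.ult q, φ n t.1 t.2 := by
  have hmem (n : ℕ) (d : U.Hyper δ) : d ∈ U.ext (U.map (fun t => {d | φ n t d}) p) ↔
      ∀ᶠ t : γ × δ in U.ult (U.pair p d), φ n t.1 t.2 := by
    induction p, d using map_induction₂ with
    | map => simp only [map_map, pair_map, map_mem_ext, mem_ofPred_eq, eventually_ult_map]
  obtain ⟨d, hd⟩ := hU.exists_forall_mem (fun n => ⟨_, rfl⟩) fun n => by
    obtain ⟨f, hf⟩ := (h n).choice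
    refine ⟨U.map f p, fun k hk => map_mem_ext.2 (hf.mono fun t ht => ht k hk)⟩
  exact ⟨U.pair p d, map_fst_pair p d, fun n => (hmem n d).1 (hd n)⟩

/-- The function whose graph is `S`, with an arbitrary value where `S` is not functional. It codes
internal functions by elements of `U.Hyper (Set (α × β))`. -/
noncomputable def evalGraph {α β : Type} [Nonempty β] (S : Set (α × β)) (x : α) : β :=
  Classical.epsilon fun y => (x, y) ∈ S

lemma evalGraph_graph {α β : Type} [Nonempty β] (f : α → β) :
    evalGraph {q : α × β | q.2 = f q.1} = f :=
  funext fun x => Classical.epsilon_spec (p := fun y => y = f x) ⟨_, rfl⟩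

/-- The internal sequence coded by `S` extends the given external one. -/
lemma CountablySaturated.exists_map_evalGraph_eq (hU : U.CountablySaturated) (x : ℕ → U.Hyper β) :
    ∃ S : U.Hyper (Set (ℕ × β)), (fun n => U.map (fun S => evalGraph S n) S) = x := by
  obtain ⟨S, hS⟩ := hU.exists_forall_mem
    (fun n => isInternal_setOf_map_eq (fun S : Set (ℕ × β) => evalGraph S n) (x n)) fun n => by
      induction n with
      | zero => exact ⟨U.std ∅, fun k hk => absurd hk k.not_lt_zero⟩
      | succ n ih =>
        obtain ⟨S, hS⟩ := ih
        let update (t : Set (ℕ × β) × β) : Set (ℕ × β) :=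
          {q | q.2 = Function.update (evalGraph t.1) n t.2 q.1}
        have heval (k : ℕ) : U.map (fun S => evalGraph S k) (U.map update (U.pair S (x n))) =
            if k = n then x n else U.map (fun S => evalGraph S k) S := by
          generalize x n = y
          induction S, y using map_induction₂ with
          | map => split_ifs <;> simp [update, pair_map, map_map, evalGraph_graph, *]
        refine ⟨U.map update (U.pair S (x n)), fun k hk => (heval k).trans ?_⟩
        split_ifs with hkn
        · rw [hkn]
        · exact hS k (by omega)
  exact ⟨S, funext hS⟩

end Saturation

section CountablyDetermined

variable {α β γ : Type} [StandardType α] [StandardType β] [StandardType γ]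

lemma IsCD.exists_separating {X : Set (U.Hyper α)} (hX : U.IsCD X) :
    ∃ A : ℕ → Set (U.Hyper α), (∀ n, U.IsInternal (A n)) ∧
      ∀ x y, (∀ n, x ∈ A n ↔ y ∈ A n) → x ∈ X → y ∈ X := by
  obtain ⟨A, B, hA, rfl⟩ := hX
  refine ⟨A, hA, fun x y hxy hx => ?_⟩
  simpa [hxy] using hx

lemma isCD_of_separating {ι : Type*} [Countable ι] {A : ι → Set (U.Hyper α)}
    (hA : ∀ i, U.IsInternal (A i)) {X : Set (U.Hyper α)}
    (hX : ∀ x y, (∀ i, x ∈ A i ↔ y ∈ A i) → x ∈ X → y ∈ X) : U.IsCD X := by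
  obtain ⟨e, he⟩ := exists_surjective_nat (Option ι)
  let A' (n : ℕ) : Set (U.Hyper α) := (e n).elim univ A
  have hA' : ⋃ n, A' n = univ := by
    obtain ⟨n, hn⟩ := he none
    exact eq_univ_of_univ_subset (subset_iUnion_of_subset n (by simp [A', hn]))
  have hsep (x y : U.Hyper α) (hxy : ∀ n, x ∈ A' n ↔ y ∈ A' n) (hx : x ∈ X) : y ∈ X := by
    refine hX x y (fun i => ?_) hx
    obtain ⟨n, hn⟩ := he (some i)
    simpa only [A', hn, Option.elim_some] using hxy n
  refine ⟨A', {b | ∃ x ∈ X, b = {m | x ∈ A' m}}, fun n => ?_, Set.ext fun y => ?_⟩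
  · rcases h : e n with _ | i
    · simpa only [A', h, Option.elim_none] using isInternal_univ
    · simpa only [A', h, Option.elim_some] using hA i
  · rw [hA']
    simp only [mem_iUnion, mem_inter_iff, mem_iInter, Set.mem_sdiff, mem_univ, true_and,
      mem_compl_iff, exists_prop]
    constructor
    · intro hy
      exact ⟨_, ⟨y, hy, rfl⟩, fun _ h => h, fun _ h => h⟩
    · rintro ⟨_, ⟨x, hx, rfl⟩, hin, hout⟩
      exact hsep x y (fun n => ⟨hin n, fun h => by_contra fun hn => hout n hn h⟩) hx

lemma IsInternal.isCD {X : Set (U.Hyper α)} (hX : U.IsInternal X) : U.IsCD X :=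
  isCD_of_separating (fun _ : Unit => hX) fun _ _ h => (h ()).1

lemma IsCD.compl {X : Set (U.Hyper α)} (hX : U.IsCD X) : U.IsCD Xᶜ := by
  obtain ⟨A, hA, hsep⟩ := hX.exists_separating
  exact isCD_of_separating hA fun x y hxy hx hy => hx (hsep y x (fun n => (hxy n).symm) hy)

lemma IsCD.iUnion {ι : Type*} [Countable ι] {X : ι → Set (U.Hyper α)} (hX : ∀ i, U.IsCD (X i)) :
    U.IsCD (⋃ i, X i) := by
  choose A hA hsep using fun i => (hX i).exists_separating
  refine isCD_of_separating (A := fun q : ι × ℕ => A q.1 q.2) (fun q => hA q.1 q.2)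
    fun x y hxy hx => ?_
  obtain ⟨i, hi⟩ := mem_iUnion.1 hx
  exact mem_iUnion.2 ⟨i, hsep i x y (fun n => hxy (i, n)) hi⟩

lemma IsCD.iInter {ι : Type*} [Countable ι] {X : ι → Set (U.Hyper α)} (hX : ∀ i, U.IsCD (X i)) :
    U.IsCD (⋂ i, X i) := by
  rw [← compl_compl (⋂ i, X i), compl_iInter]
  exact (IsCD.iUnion fun i => (hX i).compl).compl

lemma IsCD.inter {X Y : Set (U.Hyper α)} (hX : U.IsCD X) (hY : U.IsCD Y) : U.IsCD (X ∩ Y) := by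
  rw [inter_eq_iInter]
  exact IsCD.iInter fun b => by cases b <;> assumption

lemma IsCD.preimage {Y : Set (U.Hyper β)} (hY : U.IsCD Y) (f : α → β) :
    U.IsCD (U.map f ⁻¹' Y) := by
  obtain ⟨A, hA, hsep⟩ := hY.exists_separating
  exact isCD_of_separating (fun n => (hA n).preimage f) fun x y hxy hx => hsep _ _ hxy hx

lemma IsCD.exists_countable_codes {X : Set (U.Hyper α)} (hX : U.IsCD X) :
    ∃ 𝒜 : Set (U.Hyper (Set α)), 𝒜.Countable ∧ ∀ x ∈ X, ∃ a : ℕ → U.Hyper (Set α),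
      (∀ n, a n ∈ 𝒜 ∧ x ∈ U.ext (a n)) ∧ Antitone (fun n => U.ext (a n)) ∧
      ⋂ n, U.ext (a n) ⊆ X := by
  classical
  obtain ⟨A, hA, hsep⟩ := hX.exists_separating
  have hint (q : ℕ × Finset ℕ) :
      U.IsInternal (⋂ k < q.1, if k ∈ q.2 then A k else (A k)ᶜ) :=
    IsInternal.biInter_lt (fun k => by split_ifs; exacts [hA k, (hA k).compl]) q.1
  choose code hcode using hint
  refine ⟨range code, countable_range code, fun x hx => ?_⟩
  let a (n : ℕ) : U.Hyper (Set α) := code (n, {k ∈ Finset.range n | x ∈ A k})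
  have ha (n : ℕ) (y : U.Hyper α) : y ∈ U.ext (a n) ↔ ∀ k < n, x ∈ A k ↔ y ∈ A k := by
    simp only [a, ← hcode, mem_iInter]
    refine forall₂_congr fun k hk => ?_
    by_cases hxk : x ∈ A k <;> simp [hk, hxk]
  refine ⟨a, fun n => ⟨mem_range_self _, (ha n x).2 fun _ _ => Iff.rfl⟩,
    fun m n hmn y hy => (ha m y).2 fun k hk => (ha n y).1 hy k (hk.trans_le hmn), fun y hy => ?_⟩
  exact hsep x y (fun n => (ha (n + 1) y).1 (mem_iInter.1 hy _) n n.lt_succ_self) hx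

lemma IsCD.exists_cover {X : Set (U.Hyper α)} (hX : U.IsCD X) {P : U.Hyper (Set α) → Prop}
    (hne : ∃ a, P a) (hP : ∀ a : ℕ → U.Hyper (Set α), Antitone (fun n => U.ext (a n)) →
      ⋂ n, U.ext (a n) ⊆ X → ∃ n, P (a n)) :
    ∃ b : ℕ → U.Hyper (Set α), (∀ n, P (b n)) ∧ X ⊆ ⋃ n, U.ext (b n) := by
  obtain ⟨a₀, ha₀⟩ := hne
  obtain ⟨𝒜, h𝒜, hmem⟩ := hX.exists_countable_codes
  obtain ⟨b, hb⟩ := ((h𝒜.mono (sep_subset 𝒜 P)).insert a₀).exists_eq_range (insert_nonempty _ _)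
  refine ⟨b, fun n => ?_, fun x hx => ?_⟩
  · obtain h | h : b n ∈ insert a₀ {a ∈ 𝒜 | P a} := hb ▸ mem_range_self n
    exacts [h ▸ ha₀, h.2]
  · obtain ⟨a, ha, hanti, hsub⟩ := hmem x hx
    obtain ⟨n, hn⟩ := hP a hanti hsub
    obtain ⟨m, hm⟩ : a n ∈ range b := hb ▸ mem_insert_of_mem _ ⟨(ha n).1, hn⟩
    exact mem_iUnion.2 ⟨m, hm ▸ (ha n).2⟩

lemma IsCD.image (hU : U.CountablySaturated) {X : Set (U.Hyper α)} (hX : U.IsCD X) (f : α → β) :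
    U.IsCD (U.map f '' X) := by
  obtain ⟨𝒜, h𝒜, hmem⟩ := hX.exists_countable_codes
  have := h𝒜.to_subtype
  refine isCD_of_separating (A := fun a : 𝒜 => U.map f '' U.ext a)
    (fun a => IsInternal.image ⟨_, rfl⟩ f) ?_
  rintro _ y hy ⟨x, hx, rfl⟩
  obtain ⟨a, ha, hanti, hsub⟩ := hmem x hx
  have hfiber (n : ℕ) : (U.ext (a n) ∩ {x | U.map f x = y}).Nonempty :=
    (hy ⟨a n, (ha n).1⟩).1 (mem_image_of_mem _ (ha n).2)
  obtain ⟨z, hz⟩ := hU.nonempty_iInter_of_antitone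
    (fun n => IsInternal.inter ⟨_, rfl⟩ (isInternal_setOf_map_eq f y))
    (hanti.inter antitone_const) hfiber
  rw [← iInter_inter] at hz
  exact ⟨z, hsub hz.1, hz.2⟩

lemma IsCD.comp (hU : U.CountablySaturated) {R : Set (U.Hyper (α × β))} {S : Set (U.Hyper (β × γ))}
    (hR : U.IsCD R) (hS : U.IsCD S) :
    U.IsCD {p | ∃ y, U.pair (U.map Prod.fst p) y ∈ R ∧ U.pair y (U.map Prod.snd p) ∈ S} :=
  image_inter_preimage_eq_comp R S ▸ ((hR.preimage _).inter (hS.preimage _)).image hU _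

end CountablyDetermined

section Reducibility

variable {X Y Z : Set (U.Hyper ℕ)}

lemma graphOn_eq (X : Set (U.Hyper ℕ)) (f : U.Hyper ℕ → U.Hyper ℕ) :
    U.graphOn X f =
      {p | U.map Prod.fst p ∈ X ∧ U.map Prod.snd p = f (U.map Prod.fst p)} := by
  ext p
  obtain ⟨x, y, rfl⟩ := exists_pair_eq p
  simp only [graphOn, mem_ofPred_eq, pair_inj, map_fst_pair, map_snd_pair]
  constructor
  · rintro ⟨_, hx, rfl, rfl⟩
    exact ⟨hx, rfl⟩
  · exact fun h => ⟨x, h.1, rfl, h.2⟩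

lemma isCD_graphOn_of_isInternalMap (hX : U.IsCD X) {f : U.Hyper ℕ → U.Hyper ℕ}
    (hf : IsInternalMap f) : U.IsCD (U.graphOn X f) := by
  rw [graphOn_eq]
  exact (hX.preimage Prod.fst).inter hf.isCD

lemma CDLe.of_isInternalMap (hX : U.IsCD X) {f : U.Hyper ℕ → U.Hyper ℕ} (hf : IsInternalMap f)
    (hmaps : MapsTo f X Y) (hinj : InjOn f X) : U.CDLe X Y :=
  ⟨f, hmaps, hinj, isCD_graphOn_of_isInternalMap hX hf⟩

lemma CDLe.of_subset (hX : U.IsCD X) (hXY : X ⊆ Y) : U.CDLe X Y :=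
  .of_isInternalMap hX isInternalMap_id hXY (injOn_id X)

lemma CDLe.trans (hU : U.CountablySaturated) (hXY : U.CDLe X Y) (hYZ : U.CDLe Y Z) :
    U.CDLe X Z := by
  obtain ⟨f, hf, hfinj, hfCD⟩ := hXY
  obtain ⟨g, hg, hginj, hgCD⟩ := hYZ
  refine ⟨g ∘ f, hg.comp hf, hginj.comp hfinj hf, ?_⟩
  convert hfCD.comp hU hgCD using 1
  ext p
  simp only [graphOn_eq, mem_ofPred_eq, map_fst_pair, map_snd_pair, Function.comp_apply]
  constructor
  · exact fun ⟨hx, hp⟩ => ⟨_, ⟨hx, rfl⟩, hf hx, hp⟩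
  · rintro ⟨_, ⟨hx, rfl⟩, -, hp⟩
    exact ⟨hx, hp⟩

lemma CDLe.mono_right (h : U.CDLe X Y) (hYZ : Y ⊆ Z) : U.CDLe X Z := by
  obtain ⟨f, hf, hinj, hCD⟩ := h
  exact ⟨f, hf.mono_right hYZ, hinj, hCD⟩

lemma CDLe.iUnion {ι : Type*} [Countable ι] {X Y : ι → Set (U.Hyper ℕ)}
    (h : ∀ i, U.CDLe (X i) (Y i)) (hX : Pairwise (Function.onFun Disjoint X))
    (hY : Pairwise (Function.onFun Disjoint Y)) : U.CDLe (⋃ i, X i) (⋃ i, Y i) := by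
  classical
  choose g hg hginj hgCD using h
  let f (x : U.Hyper ℕ) : U.Hyper ℕ := if hx : ∃ i, x ∈ X i then g hx.choose x else x
  have hf (i : ι) (x : U.Hyper ℕ) (hx : x ∈ X i) : f x = g i x := by
    have hex : ∃ i, x ∈ X i := ⟨i, hx⟩
    have hi : hex.choose = i := hX.eq (not_disjoint_iff.2 ⟨x, hex.choose_spec, hx⟩)
    simp only [f, dif_pos hex, hi]
  have hfY (i : ι) (x : U.Hyper ℕ) (hx : x ∈ X i) : f x ∈ Y i := hf i x hx ▸ hg i hx
  refine ⟨f, fun x hx => ?_, fun x hx y hy hxy => ?_, ?_⟩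
  · obtain ⟨i, hi⟩ := mem_iUnion.1 hx
    exact mem_iUnion.2 ⟨i, hfY i x hi⟩
  · obtain ⟨i, hi⟩ := mem_iUnion.1 hx
    obtain ⟨j, hj⟩ := mem_iUnion.1 hy
    obtain rfl : i = j := hY.eq (not_disjoint_iff.2 ⟨f x, hfY i x hi, hxy ▸ hfY j y hj⟩)
    rw [hf i x hi, hf i y hj] at hxy
    exact hginj i hi hj hxy
  · convert IsCD.iUnion hgCD using 1
    ext p
    simp only [graphOn_eq, mem_ofPred_eq, mem_iUnion, ← exists_and_right]
    exact exists_congr fun i => and_congr_right fun hp => by rw [hf i _ hp]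

lemma CDLe.infinite (h : U.CDLe X Y) (hX : X.Infinite) : Y.Infinite := by
  obtain ⟨f, hf, hinj, -⟩ := h
  exact (hX.image hinj).mono hf.image_subset

end Reducibility

section Cardinality

variable {α β γ : Type} [StandardType α] [StandardType β] [StandardType γ]

lemma injOn_app {h : γ → α → β} {p : U.Hyper γ} {F : γ → Set α}
    (hinj : ∀ᶠ t in U.ult p, InjOn (h t) (F t)) : InjOn (app h p) (U.ext (U.map F p)) := by
  intro x hx y hy hxy
  induction p, x, y using map_induction₃ with
  | map =>
    simp only [map_map, map_mem_ext, app_map, map_eq_map, eventually_ult_map] at *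
    filter_upwards [hinj, hx, hy, hxy] with t hinj hx hy hxy using hinj hx hy hxy

lemma mapsTo_app {h : γ → α → β} {p : U.Hyper γ} {F : γ → Set α} {G : γ → Set β}
    (hmaps : ∀ᶠ t in U.ult p, MapsTo (h t) (F t) (G t)) :
    MapsTo (app h p) (U.ext (U.map F p)) (U.ext (U.map G p)) := by
  intro x hx
  induction p, x using map_induction₂ with
  | map =>
    simp only [map_map, map_mem_ext, app_map, eventually_ult_map] at *
    filter_upwards [hmaps, hx] with t hmaps hx using hmaps hx

/-- The hyperinteger `c` is less than the internal cardinality of the internal set given by `a`. -/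
def LtCard (c : U.Hyper ℕ) (a : U.Hyper (Set α)) : Prop :=
  U.pair c a ∈ U.starSet {p : ℕ × Set α | (p.1 : ℕ∞) < p.2.encard}

lemma ltCard_map {p : U.Hyper γ} {f : γ → ℕ} {F : γ → Set α} :
    LtCard (U.map f p) (U.map F p) ↔ ∀ᶠ t in U.ult p, (f t : ℕ∞) < (F t).encard := by
  rw [LtCard, pair_map, map_mem_starSet]
  rfl

lemma not_ltCard_map {p : U.Hyper γ} {f : γ → ℕ} {F : γ → Set α} :
    ¬ LtCard (U.map f p) (U.map F p) ↔ ∀ᶠ t in U.ult p, (F t).encard ≤ f t := by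
  simp only [ltCard_map, ← Ultrafilter.eventually_not, not_lt]

lemma setOf_ltCard (a : U.Hyper (Set α)) :
    {c | LtCard c a} = U.ext (U.map (fun A => {n : ℕ | (n : ℕ∞) < A.encard}) a) := by
  ext c
  induction c, a using map_induction₂ with
  | map => simp only [mem_ofPred_eq, ltCard_map, map_map, map_mem_ext]

lemma isInternal_setOf_ltCard (a : U.Hyper (Set α)) : U.IsInternal {c | LtCard c a} :=
  ⟨_, setOf_ltCard a⟩

lemma Iio_eq_ext (c : U.Hyper ℕ) : Iio c = U.ext (U.map Iio c) := by
  ext x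
  induction x, c using map_induction₂ with
  | map => simp only [mem_Iio, map_lt_map, map_map, map_mem_ext]

lemma isInternal_Iic (c : U.Hyper ℕ) : U.IsInternal (Iic c) := by
  refine ⟨U.map Iic c, Set.ext fun x => ?_⟩
  induction x, c using map_induction₂ with
  | map => simp only [mem_Iic, map_le_map, map_map, map_mem_ext]

lemma exists_not_ltCard (c : U.Hyper ℕ) : ∃ a : U.Hyper (Set α), ¬ LtCard c a := by
  induction c using map_induction with
  | map p f =>
    exact ⟨U.map (fun _ => ∅) p, not_ltCard_map.2 (Eventually.of_forall fun t => by simp)⟩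

lemma lt_map_ncard_iff {a : U.Hyper (Set α)} {c d : U.Hyper ℕ} (h : ¬ LtCard d a) :
    c < U.map ncard a ↔ LtCard c a := by
  induction a, c, d using map_induction₃ with
  | map =>
    rw [not_ltCard_map] at h
    rw [map_map, map_lt_map, ltCard_map]
    refine eventually_congr (h.mono fun t ht => ?_)
    rw [← (finite_of_encard_le_coe ht).cast_ncard_eq, Nat.cast_lt]

lemma LtCard.of_le {a : U.Hyper (Set α)} {c d : U.Hyper ℕ} (h : LtCard c a) (hdc : d ≤ c) :
    LtCard d a := by
  induction a, c, d using map_induction₃ with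
  | map =>
    rw [ltCard_map] at *
    rw [map_le_map] at hdc
    filter_upwards [h, hdc] with t h hdc using (Nat.cast_le.2 hdc).trans_lt h

lemma LtCard.mono {a b : U.Hyper (Set α)} {c : U.Hyper ℕ} (h : LtCard c a)
    (hab : U.ext a ⊆ U.ext b) : LtCard c b := by
  induction c, a, b using map_induction₃ with
  | map =>
    rw [ltCard_map] at *
    rw [ext_map_subset] at hab
    filter_upwards [h, hab] with t h hab using h.trans_le (encard_le_encard hab)

lemma CountablySaturated.exists_enumeration (hU : U.CountablySaturated) {Z : ℕ → U.Hyper (Set α)}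
    (hZ : ∀ i j, U.ext (Z i) ⊆ U.ext (Z j) ∨ U.ext (Z j) ⊆ U.ext (Z i)) :
    ∃ f : U.Hyper ℕ → U.Hyper α, IsInternalMap f ∧
      ∀ k, InjOn f {c | LtCard c (Z k)} ∧ MapsTo f {c | LtCard c (Z k)} (U.ext (Z k)) := by
  obtain ⟨p, rfl⟩ := hU.exists_map_evalGraph_eq Z
  simp only [ext_map_subset, ← Ultrafilter.eventually_or] at hZ
  obtain ⟨q, rfl, hq⟩ := hU.exists_forall_eventually p (fun k F (S : Set (ℕ × α)) =>
      InjOn (evalGraph S) {y : ℕ | (y : ℕ∞) < (evalGraph F k).encard} ∧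
        MapsTo (evalGraph S) {y : ℕ | (y : ℕ∞) < (evalGraph F k).encard} (evalGraph F k)) (by
    intro n
    filter_upwards [eventually_all.2 fun i : Iio n => eventually_all.2 fun j : Iio n => hZ i j]
      with F hF
    obtain ⟨f, hf, hfF⟩ := exists_enumeration_of_chain (fun k : Iio n => evalGraph F k) hF
    refine ⟨{q | q.2 = f q.1}, fun k hk => ?_⟩
    rw [evalGraph_graph]
    exact ⟨hf.mono (ofPred_subset_ofPred.2 fun _ hy => ⟨⟨k, hk⟩, hy⟩), hfF ⟨k, hk⟩⟩)
  refine ⟨_, isInternalMap_app (fun t => evalGraph t.2) q, fun k => ?_⟩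
  simp only [setOf_ltCard, map_map]
  exact ⟨injOn_app ((hq k).mono fun t ht => ht.1), mapsTo_app ((hq k).mono fun t ht => ht.2)⟩

lemma CountablySaturated.exists_ranking (hU : U.CountablySaturated) {Z : ℕ → U.Hyper (Set α)}
    (hZ : ∀ i j, U.ext (Z i) ⊆ U.ext (Z j) ∨ U.ext (Z j) ⊆ U.ext (Z i))
    {d : ℕ → U.Hyper ℕ} (hd : ∀ k, ¬ LtCard (d k) (Z k)) :
    ∃ g : U.Hyper α → U.Hyper ℕ, IsInternalMap g ∧
      ∀ k, InjOn g (U.ext (Z k)) ∧ MapsTo g (U.ext (Z k)) (Iio (d k)) := by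
  obtain ⟨P, rfl⟩ := hU.exists_map_evalGraph_eq Z
  obtain ⟨R, rfl⟩ := hU.exists_map_evalGraph_eq d
  obtain ⟨p, rfl, rfl⟩ : ∃ p, U.map Prod.fst p = P ∧ U.map Prod.snd p = R :=
    ⟨U.pair P R, map_fst_pair P R, map_snd_pair P R⟩
  simp only [map_map, ext_map_subset, ← Ultrafilter.eventually_or, not_ltCard_map] at hZ hd
  obtain ⟨q, rfl, hq⟩ := hU.exists_forall_eventually p (fun k t (S : Set (α × ℕ)) =>
      InjOn (evalGraph S) (evalGraph t.1 k) ∧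
        MapsTo (evalGraph S) (evalGraph t.1 k) (Iio (evalGraph t.2 k))) (by
    intro n
    filter_upwards [eventually_all.2 fun i : Iio n => eventually_all.2 fun j : Iio n => hZ i j,
      eventually_all.2 fun i : Iio n => hd i] with t hchain hcard
    obtain ⟨g, hg⟩ := exists_ranking_of_chain (fun k : Iio n => evalGraph t.1 k) hchain _ hcard
    refine ⟨{q | q.2 = g q.1}, fun k hk => ?_⟩
    rw [evalGraph_graph]
    exact hg ⟨k, hk⟩)
  refine ⟨_, isInternalMap_app (fun t => evalGraph t.2) q, fun k => ?_⟩
  simp only [Iio_eq_ext, map_map]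
  exact ⟨injOn_app ((hq k).mono fun t ht => ht.1), mapsTo_app ((hq k).mono fun t ht => ht.2)⟩

lemma CountablySaturated.exists_injOn_mapsTo_Iio (hU : U.CountablySaturated)
    {a : U.Hyper (Set α)} {d : U.Hyper ℕ} (h : ¬ LtCard d a) :
    ∃ g : U.Hyper α → U.Hyper ℕ,
      IsInternalMap g ∧ InjOn g (U.ext a) ∧ MapsTo g (U.ext a) (Iio d) := by
  obtain ⟨g, hg, hga⟩ := hU.exists_ranking (Z := fun _ => a) (d := fun _ => d)
    (fun _ _ => .inl Subset.rfl) fun _ => h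
  exact ⟨g, hg, hga 0⟩

lemma CountablySaturated.exists_iUnion_subset_ext (hU : U.CountablySaturated)
    {b : ℕ → U.Hyper (Set α)} {c d : U.Hyper ℕ} (hc : c ∈ U.divNat d) (hb : ∀ n, ¬ LtCard c (b n)) :
    ∃ a, (⋃ n, U.ext (b n)) ⊆ U.ext a ∧ ¬ LtCard d a := by
  obtain ⟨P, rfl⟩ := hU.exists_map_evalGraph_eq b
  induction P, c, d using map_induction₃ with
  | map p F f g =>
    simp only [map_map, not_ltCard_map] at hb
    simp only [divNat, mem_ofPred_eq, std_eq_map _ p, map_mul_map, map_le_map] at hc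
    obtain ⟨q, rfl, hq⟩ := hU.exists_forall_eventually p (fun k t (A : Set α) =>
        evalGraph (F t) k ⊆ A ∧ A.encard ≤ g t) (by
      intro n
      filter_upwards [eventually_all.2 fun k : Iio n => hb k, hc (n + 1) n.succ_pos]
        with t hcard hle
      refine ⟨⋃ k ∈ Finset.range n, evalGraph (F t) k, fun k hk =>
        ⟨subset_biUnion_of_mem (u := evalGraph (F t)) (Finset.mem_range.2 hk), ?_⟩⟩
      calc (⋃ k ∈ Finset.range n, evalGraph (F t) k).encard
        _ ≤ ∑ k ∈ Finset.range n, (evalGraph (F t) k).encard := Finset.set_encard_biUnion_le _ _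
        _ ≤ ∑ _k ∈ Finset.range n, (f t : ℕ∞) :=
          Finset.sum_le_sum fun k hk => hcard ⟨k, Finset.mem_range.1 hk⟩
        _ = (n * f t : ℕ) := by simp
        _ ≤ g t := Nat.cast_le.2 ((Nat.mul_le_mul_right _ n.le_succ).trans hle))
    refine ⟨U.map Prod.snd q, iUnion_subset fun n => ?_, ?_⟩
    · simp only [map_map, ext_map_subset]
      exact (hq n).mono fun t ht => ht.1
    · rw [map_map, not_ltCard_map]
      exact (hq 0).mono fun t ht => ht.2

end Cardinality

section Packing

variable {X Y : Set (U.Hyper ℕ)}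

lemma CountablySaturated.cdLe_iInter_ext (hU : U.CountablySaturated) {Z : ℕ → U.Hyper (Set ℕ)}
    (hZ : Antitone fun n => U.ext (Z n)) :
    U.CDLe {c | ∀ k, LtCard c (Z k)} (⋂ k, U.ext (Z k)) := by
  obtain ⟨f, hf, hfZ⟩ := hU.exists_enumeration fun i j => (le_total i j).symm.imp (hZ ·) (hZ ·)
  refine .of_isInternalMap ?_ hf (fun c hc => mem_iInter.2 fun k => (hfZ k).2 (hc k))
    ((hfZ 0).1.mono fun c hc => hc 0)
  rw [ofPred_forall]
  exact IsCD.iInter fun k => (isInternal_setOf_ltCard _).isCD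

lemma CountablySaturated.cdLe_of_iUnion_ext_subset (hU : U.CountablySaturated)
    {Z : ℕ → U.Hyper (Set ℕ)} (hZX : ∀ k, U.ext (Z k) ⊆ X) :
    U.CDLe {c | ∃ k, LtCard c (Z k)} X := by
  choose Z' hZ' using IsInternal.accumulate (U := U) (X := fun k => U.ext (Z k)) fun k => ⟨_, rfl⟩
  have hmono : Monotone fun k => U.ext (Z' k) := by
    simpa only [← hZ'] using monotone_accumulate
  have hZZ' (k : ℕ) : U.ext (Z k) ⊆ U.ext (Z' k) :=
    hZ' k ▸ subset_accumulate (s := fun k => U.ext (Z k))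
  have hZ'X (k : ℕ) : U.ext (Z' k) ⊆ X := hZ' k ▸ iUnion₂_subset fun j _ => hZX j
  obtain ⟨f, hf, hfZ⟩ := hU.exists_enumeration fun i j => (le_total i j).imp (hmono ·) (hmono ·)
  refine .of_isInternalMap ?_ hf (fun c ⟨k, hk⟩ => hZ'X k ((hfZ k).2 (hk.mono (hZZ' k)))) ?_
  · rw [ofPred_exists]
    exact IsCD.iUnion fun k => (isInternal_setOf_ltCard _).isCD
  · rintro x ⟨i, hi⟩ y ⟨j, hj⟩ hxy
    exact (hfZ (max i j)).1 ((hi.mono (hZZ' i)).mono (hmono (le_max_left i j)))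
      ((hj.mono (hZZ' j)).mono (hmono (le_max_right i j))) hxy

lemma CountablySaturated.cdLe_of_subset_iInter (hU : U.CountablySaturated) (hX : U.IsCD X)
    {Z : ℕ → U.Hyper (Set ℕ)} (hXZ : ∀ k, X ⊆ U.ext (Z k))
    {d : ℕ → U.Hyper ℕ} (hd : ∀ k, ¬ LtCard (d k) (Z k)) : U.CDLe X {c | ∀ k, c < d k} := by
  choose Z' hZ' using IsInternal.dissipate (U := U) (X := fun k => U.ext (Z k)) fun k => ⟨_, rfl⟩
  have hanti : Antitone fun k => U.ext (Z' k) := by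
    simpa only [← hZ'] using antitone_dissipate
  have hZ'Z (k : ℕ) : U.ext (Z' k) ⊆ U.ext (Z k) := hZ' k ▸ dissipate_subset le_rfl
  have hXZ' (k : ℕ) : X ⊆ U.ext (Z' k) := hZ' k ▸ subset_iInter₂ fun j _ => hXZ j
  obtain ⟨g, hg, hgZ⟩ := hU.exists_ranking
    (fun i j => (le_total i j).symm.imp (hanti ·) (hanti ·)) fun k h => hd k (h.mono (hZ'Z k))
  exact .of_isInternalMap hX hg (fun x hx k => (hgZ k).2 (hXZ' k hx)) ((hgZ 0).1.mono (hXZ' 0))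

/-- The part of `X` first covered by `Z k` is sent into the segment `[D k, D (k + 1))`. -/
lemma CountablySaturated.cdLe_of_subset_iUnion (hU : U.CountablySaturated) (hX : U.IsCD X)
    {Z : ℕ → U.Hyper (Set ℕ)} (hXZ : X ⊆ ⋃ k, U.ext (Z k)) {d D : ℕ → U.Hyper ℕ}
    (hd : ∀ k, ¬ LtCard (d k) (Z k)) (hD : ∀ k, D k + d k ≤ D (k + 1)) :
    U.CDLe X {x | ∃ k, x < D k} := by
  choose g hg hginj hgmaps using fun k => hU.exists_injOn_mapsTo_Iio (hd k)
  have hmono : Monotone D := monotone_nat_of_le_succ fun k => le_self_add.trans (hD k)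
  let P (k : ℕ) : Set (U.Hyper ℕ) := X ∩ disjointed (fun k => U.ext (Z k)) k
  have hPZ (k : ℕ) : P k ⊆ U.ext (Z k) := inter_subset_right.trans (disjointed_subset _ k)
  have hP (k : ℕ) : U.CDLe (P k) (Ico (D k) (D (k + 1))) := by
    refine .of_isInternalMap (hX.inter (IsInternal.disjointed (fun k => ⟨_, rfl⟩) k).isCD)
      ((hg k).const_add (D k)) (fun x hx => ⟨le_self_add, ?_⟩)
      fun x hx y hy hxy => hginj k (hPZ k hx) (hPZ k hy) (add_left_cancel hxy)
    exact (add_lt_add_right (hgmaps k (hPZ k hx)) _).trans_le (hD k)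
  have hXP : X = ⋃ k, P k := by
    rw [← inter_iUnion, iUnion_disjointed, inter_eq_left.2 hXZ]
  rw [hXP]
  refine (CDLe.iUnion hP ?_ hmono.pairwise_disjoint_on_Ico_succ).mono_right
    (iUnion_subset fun k x hx => ⟨k + 1, hx.2⟩)
  exact (disjoint_disjointed _).mono fun i j => .mono inter_subset_right inter_subset_right

end Packing

section Counting

variable {α β γ : Type} [StandardType α] [StandardType β] [StandardType γ]

lemma eventually_injOn_of_injOn_map {f : α → β} {F : γ → Set α} {p : U.Hyper γ}
    (h : InjOn (U.map f) (U.ext (U.map F p))) : ∀ᶠ t in U.ult p, InjOn f (F t) := by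
  by_contra hnot
  have hex : ∀ᶠ t in U.ult p, ∃ w : α × α,
      w.1 ∈ F t ∧ w.2 ∈ F t ∧ f w.1 = f w.2 ∧ w.1 ≠ w.2 := by
    filter_upwards [Ultrafilter.eventually_not.2 hnot] with t ht
    simp only [InjOn, not_forall] at ht
    obtain ⟨x, hx, y, hy, hxy, hne⟩ := ht
    exact ⟨(x, y), hx, hy, hxy, hne⟩
  obtain ⟨g, hg⟩ := hex.choice
  have heq : U.map (fun t => (g t).1) p = U.map (fun t => (g t).2) p :=
    h (map_mem_ext.2 (hg.mono fun t ht => ht.1)) (map_mem_ext.2 (hg.mono fun t ht => ht.2.1))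
      (by simpa only [map_map, map_eq_map] using hg.mono fun t ht => ht.2.2.1)
  obtain ⟨t, ht, heq⟩ := (hg.and (map_eq_map.1 heq)).exists
  exact ht.2.2.2 heq

lemma isInternal_setOf_map_eq_map (f g : α → β) : U.IsInternal {x | U.map f x = U.map g x} := by
  refine ⟨U.std {t | f t = g t}, Set.ext fun x => ?_⟩
  induction x using map_induction with
  | map p =>
    simp only [mem_ofPred_eq, map_eq_map, std_eq_map _ p, map_mem_ext, eventually_ult_map]

lemma CountablySaturated.exists_injOn_map_ext (hU : U.CountablySaturated) {f : α → β}
    {a : ℕ → U.Hyper (Set α)} (ha : Antitone fun n => U.ext (a n))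
    (hinj : InjOn (U.map f) (⋂ n, U.ext (a n))) : ∃ n, InjOn (U.map f) (U.ext (a n)) := by
  by_contra! hnot
  let E : Set (U.Hyper (α × α)) :=
    {w | U.map (fun t => f t.1) w = U.map (fun t => f t.2) w} ∩
      {w | U.map Prod.fst w = U.map Prod.snd w}ᶜ
  have hE : U.IsInternal E :=
    (isInternal_setOf_map_eq_map _ _).inter (isInternal_setOf_map_eq_map _ _).compl
  let W (n : ℕ) : Set (U.Hyper (α × α)) :=
    U.map Prod.fst ⁻¹' U.ext (a n) ∩ U.map Prod.snd ⁻¹' U.ext (a n) ∩ E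
  have hW (n : ℕ) : U.IsInternal (W n) :=
    ((IsInternal.preimage ⟨_, rfl⟩ _).inter (IsInternal.preimage ⟨_, rfl⟩ _)).inter hE
  obtain ⟨w, hw⟩ := hU.nonempty_iInter_of_antitone hW
    (fun m n hmn w hw => ⟨⟨ha hmn hw.1.1, ha hmn hw.1.2⟩, hw.2⟩) fun n => by
      have hn := hnot n
      simp only [InjOn, not_forall] at hn
      obtain ⟨x, hx, y, hy, hxy, hne⟩ := hn
      refine ⟨U.pair x y,
        ⟨by rwa [mem_preimage, map_fst_pair], by rwa [mem_preimage, map_snd_pair]⟩, ?_, ?_⟩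
      · rwa [mem_ofPred_eq, ← map_map (g := f) (f := Prod.fst), ← map_map (g := f) (f := Prod.snd),
          map_fst_pair, map_snd_pair]
      · simpa only [mem_compl_iff, mem_ofPred_eq, map_fst_pair, map_snd_pair]
  rw [mem_iInter] at hw
  refine (hw 0).2.2 (hinj (mem_iInter.2 fun n => (hw n).1.1) (mem_iInter.2 fun n => (hw n).1.2) ?_)
  simpa only [mem_ofPred_eq, map_map] using (hw 0).2.1

lemma CountablySaturated.exists_lt_forall_lt_two_pow_mul (hU : U.CountablySaturated)
    {d : U.Hyper ℕ} (hd : U.IsInfinitelyLarge d) {R : ℕ → U.Hyper (Set (ℕ × ℕ))}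
    (hR : ∀ k, InjOn (U.map Prod.snd) (U.ext (R k))) :
    ∃ x < d, ∀ k y, U.pair x y ∈ U.ext (R k) → d < ((2 ^ (k + 2) : ℕ) : U.Hyper ℕ) * y := by
  obtain ⟨S, rfl⟩ := hU.exists_map_evalGraph_eq R
  rw [isInfinitelyLarge_iff] at hd
  obtain ⟨p, rfl, rfl⟩ : ∃ p, U.map Prod.fst p = S ∧ U.map Prod.snd p = d :=
    ⟨U.pair S d, map_fst_pair S d, map_snd_pair S d⟩
  simp only [map_map] at hR
  simp only [natCast_eq_map _ p, map_lt_map] at hd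
  obtain ⟨q, rfl, hq⟩ := hU.exists_forall_eventually p (fun k t (x : ℕ) =>
      x < t.2 ∧ ∀ y, (x, y) ∈ evalGraph t.1 k → t.2 < 2 ^ (k + 2) * y) (by
    intro n
    filter_upwards [eventually_all.2 fun k : Iio n => eventually_injOn_of_injOn_map (hR k),
      hd (2 * n)] with t hinj hn
    obtain ⟨x, hx, hxF⟩ :=
      _root_.exists_lt_forall_lt_two_pow_mul (fun k hk => hinj ⟨k, hk⟩) hn
    exact ⟨x, fun k hk => ⟨hx, hxF k hk⟩⟩)
  refine ⟨U.map Prod.snd q, ?_, fun k y => ?_⟩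
  · rw [map_map, map_lt_map]
    exact (hq 0).mono fun t ht => ht.1
  · induction q, y using map_induction₂ with
    | map q =>
      simp only [natCast_eq_map _ q, map_map, pair_map, map_mem_ext, map_mul_map, map_lt_map,
        eventually_ult_map] at hq ⊢
      exact fun hy => hy.mp ((hq k).mono fun t ht => ht.2 _)

lemma CountablySaturated.not_cdLe_Iio_divNat (hU : U.CountablySaturated) {d : U.Hyper ℕ}
    (hd : U.IsInfinitelyLarge d) : ¬ U.CDLe (Iio d) (U.divNat d) := by
  rintro ⟨f, hf, hinj, hCD⟩
  have hgraph : InjOn (U.map Prod.snd) (U.graphOn (Iio d) f) := by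
    rintro _ ⟨x, hx, rfl⟩ _ ⟨y, hy, rfl⟩ hxy
    rw [map_snd_pair, map_snd_pair] at hxy
    rw [hinj hx hy hxy]
  obtain ⟨a₀, ha₀⟩ := isInternal_singleton (U.pair d d)
  obtain ⟨R, hR, hcover⟩ := hCD.exists_cover (P := fun a => InjOn (U.map Prod.snd) (U.ext a))
    ⟨a₀, ha₀ ▸ injOn_singleton _ _⟩ fun a ha hsub => hU.exists_injOn_map_ext ha (hgraph.mono hsub)
  obtain ⟨x, hx, hxR⟩ := hU.exists_lt_forall_lt_two_pow_mul hd hR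
  obtain ⟨k, hk⟩ := mem_iUnion.1 (hcover ⟨x, hx, rfl⟩)
  exact (hxR k _ hk).not_ge (hf hx _ (by positivity))

end Counting

section Cuts

variable {X C C' : Set (U.Hyper ℕ)} {c d : U.Hyper ℕ}

lemma IsAdditiveCut.natCast_mul_mem (hC : U.IsAdditiveCut C) {x : U.Hyper ℕ} (hx : x ∈ C) (n : ℕ) :
    (n : U.Hyper ℕ) * x ∈ C := by
  induction n with
  | zero => exact hC.1 x hx _ (by simp)
  | succ n ih =>
    rw [Nat.cast_succ, add_one_mul]
    exact hC.2 _ ih _ hx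

lemma IsCut.lt_of_notMem (hC : U.IsCut C) (hd : d ∉ C) (hc : c ∈ C) : c < d :=
  lt_of_not_ge fun h => hd (hC c hc d h)

lemma IsAdditiveCut.subset_divNat (hC : U.IsAdditiveCut C) (hd : d ∉ C) : C ⊆ U.divNat d :=
  fun _ hx n _ => (hC.1.lt_of_notMem hd (hC.natCast_mul_mem hx n)).le

lemma IsCut.natCast_mem_of_infinite (hC : U.IsCut C) (hinf : C.Infinite) (n : ℕ) :
    (n : U.Hyper ℕ) ∈ C := by
  by_contra h
  refine hinf (((finite_Iic n).image Nat.cast).subset fun x hx => ?_)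
  obtain ⟨m, hm, rfl⟩ := le_natCast_iff.1 (hC.lt_of_notMem h hx).le
  exact mem_image_of_mem _ hm

lemma IsAdditiveCut.subset_of_cdLe (hU : U.CountablySaturated) (hC : U.IsAdditiveCut C)
    (hC' : U.IsAdditiveCut C') (hinf : C'.Infinite) (h : U.CDLe C C') : C ⊆ C' := by
  intro d hd
  by_contra hd'
  have hlarge : U.IsInfinitelyLarge d := fun n hn =>
    hd' (hn ▸ hC'.1.natCast_mem_of_infinite hinf n)
  have hIio : U.CDLe (Iio d) C :=
    .of_subset (IsInternal.isCD ⟨_, Iio_eq_ext d⟩) fun x hx => hC.1 d hd x hx.le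
  exact hU.not_cdLe_Iio_divNat hlarge ((hIio.trans hU h).mono_right (hC'.subset_divNat hd'))

lemma IsAdditiveCut.eq_of_cdEquiv (hU : U.CountablySaturated) (hC : U.IsAdditiveCut C)
    (hC' : U.IsAdditiveCut C') (hX : X.Infinite) (h : U.CDEquiv C X) (h' : U.CDEquiv C' X) :
    C = C' :=
  (hC.subset_of_cdLe hU hC' (h'.2.infinite hX) (h.1.trans hU h'.2)).antisymm
    (hC'.subset_of_cdLe hU hC (h.2.infinite hX) (h'.1.trans hU h.2))

end Cuts

section Borel

variable {α : Type} [StandardType α]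

lemma IsInternal.isBorel {X : Set (U.Hyper α)} (hX : U.IsInternal X) : U.IsBorel X :=
  MeasurableSpace.measurableSet_generateFrom hX

lemma isBorel_iUnion {X : ℕ → Set (U.Hyper α)} (hX : ∀ n, U.IsInternal (X n)) :
    U.IsBorel (⋃ n, X n) :=
  @MeasurableSet.iUnion _ _ (MeasurableSpace.generateFrom _) _ _ fun n => (hX n).isBorel

lemma isBorel_iInter {X : ℕ → Set (U.Hyper α)} (hX : ∀ n, U.IsInternal (X n)) :
    U.IsBorel (⋂ n, X n) :=
  @MeasurableSet.iInter _ _ (MeasurableSpace.generateFrom _) _ _ fun n => (hX n).isBorel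

end Borel

section DivNatMulNat

lemma divNat_eq_iInter (c : U.Hyper ℕ) :
    U.divNat c = ⋂ n : ℕ, U.map ((n + 1) * ·) ⁻¹' Iic c := by
  ext x
  induction x, c using map_induction₂ with
  | map p f g =>
    simp only [divNat, mem_ofPred_eq, mem_iInter, mem_preimage, mem_Iic, std_eq_map _ p, map_map,
      map_mul_map]
    exact ⟨fun h n => h (n + 1) n.succ_pos, fun h n hn => Nat.sub_add_cancel hn ▸ h (n - 1)⟩

lemma mulNat_eq_iUnion (c : U.Hyper ℕ) : U.mulNat c = ⋃ n : ℕ, Iic (c * n) :=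
  ofPred_exists _

lemma isCD_divNat (c : U.Hyper ℕ) : U.IsCD (U.divNat c) := by
  rw [divNat_eq_iInter]
  exact IsCD.iInter fun n => ((isInternal_Iic c).preimage _).isCD

lemma isBorel_divNat (c : U.Hyper ℕ) : U.IsBorel (U.divNat c) := by
  rw [divNat_eq_iInter]
  exact isBorel_iInter fun n => (isInternal_Iic c).preimage _

lemma isBorel_mulNat (c : U.Hyper ℕ) : U.IsBorel (U.mulNat c) := by
  rw [mulNat_eq_iUnion]
  exact isBorel_iUnion fun n => isInternal_Iic _

lemma divNat_add_subset_Iic_max (x y : U.Hyper ℕ) : U.divNat (x + y) ⊆ Iic (max x y) := by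
  intro z hz
  by_contra hlt
  rw [mem_Iic, not_le, max_lt_iff] at hlt
  have hz₂ : ((2 : ℕ) : U.Hyper ℕ) * z ≤ x + y := hz 2 two_pos
  rw [Nat.cast_ofNat, two_mul] at hz₂
  exact (add_lt_add hlt.1 hlt.2).not_ge hz₂

lemma divNat_subset_Iic (c : U.Hyper ℕ) : U.divNat c ⊆ Iic c := fun x hx => by
  simpa only [mem_Iic, std_eq_natCast, Nat.cast_one, one_mul] using hx 1 one_pos

lemma divNat_mono {c d : U.Hyper ℕ} (hcd : c ≤ d) : U.divNat c ⊆ U.divNat d :=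
  fun _ hx n hn => (hx n hn).trans hcd

lemma isCut_divNat (c : U.Hyper ℕ) : U.IsCut (U.divNat c) := fun _ hx _ hyx n hn =>
  (mul_le_mul_right hyx (n : U.Hyper ℕ)).trans (hx n hn)

lemma isAdditiveCut_divNat (c : U.Hyper ℕ) : U.IsAdditiveCut (U.divNat c) := by
  refine ⟨isCut_divNat c, fun x hx y hy n hn => ?_⟩
  have hmax : max x y ∈ U.divNat c := max_rec' (· ∈ U.divNat c) hx hy
  calc (n : U.Hyper ℕ) * (x + y)
    _ ≤ n * (max x y + max x y) := by gcongr <;> simp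
    _ = ((n * 2 : ℕ) : U.Hyper ℕ) * max x y := by push_cast; ring
    _ ≤ c := hmax (n * 2) (by positivity)

lemma isAdditiveCut_mulNat (c : U.Hyper ℕ) : U.IsAdditiveCut (U.mulNat c) := by
  refine ⟨fun x ⟨n, hx⟩ y hyx => ⟨n, hyx.trans hx⟩, fun x ⟨m, hx⟩ y ⟨n, hy⟩ => ⟨m + n, ?_⟩⟩
  rw [std_eq_natCast] at *
  rw [Nat.cast_add, mul_add]
  exact add_le_add hx hy

end DivNatMulNat

section InnerCut

variable {X Y : Set (U.Hyper ℕ)} {c d : U.Hyper ℕ}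

/-- The cut of hyperintegers less than the internal cardinality of some internal subset of `X`. It
serves as the internal measure of the size of `X` from below. -/
def innerCut (X : Set (U.Hyper ℕ)) : Set (U.Hyper ℕ) :=
  {c | ∃ a, U.ext a ⊆ X ∧ LtCard c a}

lemma isCut_innerCut (X : Set (U.Hyper ℕ)) : U.IsCut (innerCut X) :=
  fun _ ⟨a, haX, hc⟩ _ hle => ⟨a, haX, hc.of_le hle⟩

lemma CountablySaturated.natCast_mem_innerCut (hU : U.CountablySaturated) (hX : X.Infinite)
    (n : ℕ) : (n : U.Hyper ℕ) ∈ innerCut X := by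
  obtain ⟨s, hsX, hcard⟩ := hX.exists_subset_card_eq (n + 1)
  obtain ⟨a, ha⟩ := isInternal_of_finite s.finite_toSet
  refine ⟨a, ha ▸ hsX, by_contra fun hlt => ?_⟩
  obtain ⟨g, -, hinj, hmaps⟩ := hU.exists_injOn_mapsTo_Iio hlt
  rw [← ha] at hinj hmaps
  have hIio : ∀ x < (n : U.Hyper ℕ), x ∈ (Finset.range n).image Nat.cast := fun x hx => by
    obtain ⟨m, -, rfl⟩ := le_natCast_iff.1 hx.le
    exact Finset.mem_image_of_mem _ (Finset.mem_range.2 (Nat.cast_lt.1 hx))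
  have hle : s.card ≤ n := calc
    s.card ≤ ((Finset.range n).image Nat.cast).card :=
      Finset.card_le_card_of_injOn g (fun x hx => hIio _ (hmaps hx)) hinj
    _ ≤ n := Finset.card_image_le.trans_eq (Finset.card_range n)
  omega

lemma CountablySaturated.isInfinitelyLarge_of_notMem_innerCut (hU : U.CountablySaturated)
    (hX : X.Infinite) (hc : c ∉ innerCut X) : U.IsInfinitelyLarge c :=
  fun n hn => hc (hn ▸ hU.natCast_mem_innerCut hX n)

lemma isInternal_setOf_ext_subset_and_ltCard (a : U.Hyper (Set ℕ)) (c : U.Hyper ℕ) :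
    U.IsInternal {b : U.Hyper (Set ℕ) | U.ext b ⊆ U.ext a ∧ LtCard c b} := by
  refine ⟨U.map (fun t => {B : Set ℕ | B ⊆ t.1 ∧ (t.2 : ℕ∞) < B.encard}) (U.pair a c),
    Set.ext fun b => ?_⟩
  induction a, b, c using map_induction₃ with
  | map =>
    simp only [mem_ofPred_eq, pair_map, map_map, map_mem_ext, ext_map_subset, ltCard_map,
      eventually_and]

lemma CountablySaturated.mem_innerCut (hU : U.CountablySaturated) {a : ℕ → U.Hyper (Set ℕ)}
    (ha : Antitone fun n => U.ext (a n)) (haX : ⋂ n, U.ext (a n) ⊆ X) (hc : ∀ n, LtCard c (a n)) :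
    c ∈ innerCut X := by
  obtain ⟨b, hb⟩ := hU.nonempty_iInter_of_antitone
    (fun n => isInternal_setOf_ext_subset_and_ltCard (a n) c)
    (fun _ _ hmn _ hb => ⟨hb.1.trans (ha hmn), hb.2⟩) fun n => ⟨a n, Subset.rfl, hc n⟩
  rw [mem_iInter] at hb
  exact ⟨b, (subset_iInter fun n => (hb n).1).trans haX, (hb 0).2⟩

lemma CountablySaturated.cdLe_of_mem_innerCut (hU : U.CountablySaturated) (hc : c ∈ innerCut X)
    (hY : U.IsCD Y) (hYc : Y ⊆ Iic c) : U.CDLe Y X := by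
  obtain ⟨a, haX, hca⟩ := hc
  exact (CDLe.of_subset hY fun x hx => (⟨0, hca.of_le (hYc hx)⟩ : ∃ _ : ℕ, LtCard x a)).trans hU
    (hU.cdLe_of_iUnion_ext_subset (Z := fun _ => a) fun _ => haX)

lemma CountablySaturated.exists_cover_of_notMem_innerCut (hU : U.CountablySaturated)
    (hX : U.IsCD X) (hc : c ∉ innerCut X) :
    ∃ b : ℕ → U.Hyper (Set ℕ), (∀ n, ¬ LtCard c (b n)) ∧ X ⊆ ⋃ n, U.ext (b n) :=
  hX.exists_cover (exists_not_ltCard c) fun a ha haX => by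
    by_contra! hlt
    exact hc (hU.mem_innerCut ha haX hlt)

lemma CountablySaturated.cdLe_mulNat_of_cover (hU : U.CountablySaturated) (hX : U.IsCD X)
    {b : ℕ → U.Hyper (Set ℕ)} (hb : ∀ n, ¬ LtCard c (b n)) (hXb : X ⊆ ⋃ n, U.ext (b n)) :
    U.CDLe X (U.mulNat c) :=
  (hU.cdLe_of_subset_iUnion hX hXb hb (D := fun k => c * k) fun k => by
    rw [Nat.cast_succ, mul_add_one]).mono_right fun _ ⟨k, hk⟩ => ⟨k, hk.le⟩

lemma CountablySaturated.cdLe_mulNat_of_notMem_innerCut (hU : U.CountablySaturated)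
    (hX : U.IsCD X) (hc : c ∉ innerCut X) : U.CDLe X (U.mulNat c) := by
  obtain ⟨b, hb, hXb⟩ := hU.exists_cover_of_notMem_innerCut hX hc
  exact hU.cdLe_mulNat_of_cover hX hb hXb

/-- If no decreasing sequence of internal sets with intersection inside `X` cuts out the inner cut,
each such sequence contains a set of cardinality at most some `e` in the cut, and countably many of
these sets cover `X`. -/
lemma CountablySaturated.innerCut_eq_or_exists_cover (hU : U.CountablySaturated) (hX : U.IsCD X)
    (hinf : X.Infinite) :
    (∃ a : ℕ → U.Hyper (Set ℕ), (Antitone fun n => U.ext (a n)) ∧ ⋂ n, U.ext (a n) ⊆ X ∧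
      innerCut X = {c | ∀ n, LtCard c (a n)}) ∨
    ∃ (b : ℕ → U.Hyper (Set ℕ)) (e : ℕ → U.Hyper ℕ),
      (∀ n, e n ∈ innerCut X ∧ ¬ LtCard (e n) (b n)) ∧ X ⊆ ⋃ n, U.ext (b n) := by
  refine or_iff_not_imp_left.2 fun hnot => ?_
  obtain ⟨b₀, hb₀⟩ := exists_not_ltCard (α := ℕ) ((0 : ℕ) : U.Hyper ℕ)
  obtain ⟨b, hb, hXb⟩ := hX.exists_cover (P := fun b => ∃ e ∈ innerCut X, ¬ LtCard e b)
    ⟨b₀, _, hU.natCast_mem_innerCut hinf 0, hb₀⟩ fun a ha haX => by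
      by_contra! hlt
      exact hnot ⟨a, ha, haX, Subset.antisymm (fun c hc n => hlt n c hc)
        fun c hc => hU.mem_innerCut ha haX hc⟩
  choose e he using hb
  exact ⟨b, e, he, hXb⟩

lemma exists_seq_mem_divNat {C : Set (U.Hyper ℕ)} (hC : ∀ d ∉ C, ¬ U.divNat d ⊆ C)
    {e : ℕ → U.Hyper ℕ} (he : ∀ n, e n ∉ C) :
    ∃ D : ℕ → U.Hyper ℕ, (∀ n, D n ∉ C) ∧ (∀ n, D (n + 1) ∈ U.divNat (D n)) ∧
      ∀ n, D (n + 1) ≤ e n := by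
  have hstep (d : U.Hyper ℕ) (hd : d ∉ C) : ∃ d', d' ∈ U.divNat d ∧ d' ∉ C := not_subset.1 (hC d hd)
  choose! next hnext hnextC using hstep
  let D : ℕ → U.Hyper ℕ := Nat.rec (e 0) fun n d => next (min d (e n))
  have hmin (n : ℕ) (hD : D n ∉ C) : min (D n) (e n) ∉ C := min_rec' (· ∉ C) hD (he n)
  have hD (n : ℕ) : D n ∉ C := by
    induction n with
    | zero => exact he 0
    | succ n ih => exact hnextC _ (hmin n ih)
  have hmem (n : ℕ) : D (n + 1) ∈ U.divNat (min (D n) (e n)) := hnext _ (hmin n (hD n))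
  exact ⟨D, hD, fun n => divNat_mono (min_le_left _ _) (hmem n),
    fun n => (divNat_subset_Iic _ (hmem n)).trans (min_le_right _ _)⟩

lemma exists_coinitial_seq_compl {a : ℕ → U.Hyper (Set ℕ)} (hd : ∃ n, ¬ LtCard d (a n)) :
    ∃ e : ℕ → U.Hyper ℕ, ∀ n, e n ∉ {c | ∀ k, LtCard c (a k)} ∧ ∀ c < e n, LtCard c (a n) := by
  refine ⟨fun n => open scoped Classical in if LtCard d (a n) then d else U.map ncard (a n),
    fun n => ?_⟩
  dsimp only
  split_ifs with h
  · exact ⟨fun h' => hd.elim fun k hk => hk (h' k), fun c hc => h.of_le hc.le⟩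
  · exact ⟨fun h' => lt_irrefl _ ((lt_map_ncard_iff h).2 (h' n)),
      fun c hc => (lt_map_ncard_iff h).1 hc⟩

lemma CountablySaturated.cdLe_innerCut_of_forall_not_divNat_subset (hU : U.CountablySaturated)
    (hX : U.IsCD X) {a : ℕ → U.Hyper (Set ℕ)} (ha : innerCut X = {c | ∀ n, LtCard c (a n)})
    (hdiv : ∀ d ∉ innerCut X, ¬ U.divNat d ⊆ innerCut X) : U.CDLe X (innerCut X) := by
  by_cases huniv : innerCut X = univ
  · exact huniv ▸ .of_subset hX (subset_univ X)
  obtain ⟨d, hd⟩ := (ne_univ_iff_exists_notMem _).1 huniv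
  rw [ha, mem_ofPred_eq, not_forall] at hd
  obtain ⟨e, he⟩ := exists_coinitial_seq_compl hd
  obtain ⟨D, hD, hdivD, hDe⟩ := exists_seq_mem_divNat hdiv fun n => ha ▸ (he n).1
  have hcover (k : ℕ) : ∃ b, X ⊆ U.ext b ∧ ¬ LtCard (D k) b := by
    obtain ⟨b, hb, hXb⟩ := hU.exists_cover_of_notMem_innerCut hX (hD (k + 1))
    obtain ⟨b', hbb', hb'⟩ := hU.exists_iUnion_subset_ext (hdivD k) hb
    exact ⟨b', hXb.trans hbb', hb'⟩
  choose b hXb hb using hcover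
  refine (hU.cdLe_of_subset_iInter hX hXb hb).mono_right fun c hc => ?_
  rw [ha]
  exact fun n => (he n).2 c ((hc (n + 1)).trans_le (hDe n))

lemma CountablySaturated.innerCut_dichotomy_of_eq (hU : U.CountablySaturated) (hX : U.IsCD X)
    (hinf : X.Infinite) {a : ℕ → U.Hyper (Set ℕ)} (hanti : Antitone fun n => U.ext (a n))
    (haX : ⋂ n, U.ext (a n) ⊆ X) (ha : innerCut X = {c | ∀ n, LtCard c (a n)}) :
    (∃ c, U.IsInfinitelyLarge c ∧ U.CDLe (U.divNat c) X ∧ U.CDLe X (U.mulNat c)) ∨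
      U.IsBorel (innerCut X) ∧ U.CDEquiv (innerCut X) X := by
  have hle : U.CDLe (innerCut X) X := ha ▸ (hU.cdLe_iInter_ext hanti).mono_right haX
  by_cases hdiv : ∃ c ∉ innerCut X, U.divNat c ⊆ innerCut X
  · obtain ⟨c, hc, hcX⟩ := hdiv
    exact .inl ⟨c, hU.isInfinitelyLarge_of_notMem_innerCut hinf hc,
      (CDLe.of_subset (isCD_divNat c) hcX).trans hU hle, hU.cdLe_mulNat_of_notMem_innerCut hX hc⟩
  · push Not at hdiv
    refine .inr ⟨?_, hle, hU.cdLe_innerCut_of_forall_not_divNat_subset hX ha hdiv⟩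
    rw [ha, ofPred_forall]
    exact isBorel_iInter fun n => isInternal_setOf_ltCard (a n)

lemma CountablySaturated.innerCut_cdEquiv_of_cofinal (hU : U.CountablySaturated) (hX : U.IsCD X)
    (hadd : U.IsAdditiveCut (innerCut X)) {b : ℕ → U.Hyper (Set ℕ)} {e : ℕ → U.Hyper ℕ}
    (he : innerCut X = ⋃ n, Iic (e n)) (hb : ∀ n, ¬ LtCard (e n) (b n))
    (hXb : X ⊆ ⋃ n, U.ext (b n)) : U.CDEquiv (innerCut X) X := by
  have hmem (n : ℕ) : e n ∈ innerCut X := he ▸ mem_iUnion.2 ⟨n, self_mem_Iic⟩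
  constructor
  · choose a haX hea using hmem
    have hCD : U.IsCD (innerCut X) := he ▸ IsCD.iUnion fun n => (isInternal_Iic (e n)).isCD
    refine (CDLe.of_subset hCD fun c hc => ?_).trans hU (hU.cdLe_of_iUnion_ext_subset haX)
    obtain ⟨n, hn⟩ := mem_iUnion.1 (he ▸ hc)
    exact ⟨n, (hea n).of_le hn⟩
  · have hsum (n : ℕ) : ∑ k ∈ Finset.range n, e k ∈ innerCut X := by
      induction n with
      | zero => exact hadd.1 _ (hmem 0) _ (by simp)
      | succ n ih =>
        rw [Finset.sum_range_succ]
        exact hadd.2 _ ih _ (hmem n)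
    exact (hU.cdLe_of_subset_iUnion hX hXb hb fun n => (Finset.sum_range_succ e n).ge).mono_right
      fun x ⟨n, hn⟩ => hadd.1 _ (hsum n) x hn.le

lemma CountablySaturated.innerCut_dichotomy_of_cover (hU : U.CountablySaturated) (hX : U.IsCD X)
    (hinf : X.Infinite) (hadd : U.IsAdditiveCut (innerCut X)) {b : ℕ → U.Hyper (Set ℕ)}
    {e : ℕ → U.Hyper ℕ} (he : ∀ n, e n ∈ innerCut X ∧ ¬ LtCard (e n) (b n))
    (hXb : X ⊆ ⋃ n, U.ext (b n)) :
    (∃ c, U.IsInfinitelyLarge c ∧ U.CDLe (U.divNat c) X ∧ U.CDLe X (U.mulNat c)) ∨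
      U.IsBorel (innerCut X) ∧ U.CDEquiv (innerCut X) X := by
  let e' (n : ℕ) : U.Hyper ℕ := max (e n) n
  have he' (n : ℕ) : e' n ∈ innerCut X :=
    max_rec' (· ∈ innerCut X) (he n).1 (hU.natCast_mem_innerCut hinf n)
  have hb (n : ℕ) : ¬ LtCard (e' n) (b n) := fun h => (he n).2 (h.of_le (le_max_left _ _))
  by_cases hbdd : ∃ c ∈ innerCut X, ∀ n, e' n ≤ c
  · obtain ⟨c, hc, hec⟩ := hbdd
    have hlarge : U.IsInfinitelyLarge c := isInfinitelyLarge_iff.2 fun n =>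
      (Nat.cast_lt.2 n.lt_succ_self).trans_le ((le_max_right _ _).trans (hec (n + 1)))
    exact .inl ⟨c, hlarge, hU.cdLe_of_mem_innerCut hc (isCD_divNat c) (divNat_subset_Iic c),
      hU.cdLe_mulNat_of_cover hX (fun n h => hb n (h.of_le (hec n))) hXb⟩
  · push Not at hbdd
    have heq : innerCut X = ⋃ n, Iic (e' n) := Subset.antisymm
      (fun c hc => mem_iUnion.2 ((hbdd c hc).imp fun n hn => hn.le))
      (iUnion_subset fun n x hx => isCut_innerCut X _ (he' n) x hx)
    exact .inr ⟨heq ▸ isBorel_iUnion fun n => isInternal_Iic (e' n),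
      hU.innerCut_cdEquiv_of_cofinal hX hadd heq hb hXb⟩

lemma CountablySaturated.innerCut_dichotomy (hU : U.CountablySaturated) (hX : U.IsCD X)
    (hinf : X.Infinite) :
    (∃ c, U.IsInfinitelyLarge c ∧ U.CDLe (U.divNat c) X ∧ U.CDLe X (U.mulNat c)) ∨
      U.IsAdditiveCut (innerCut X) ∧ U.IsBorel (innerCut X) ∧ U.CDEquiv (innerCut X) X := by
  by_cases hadd : ∀ x ∈ innerCut X, ∀ y ∈ innerCut X, x + y ∈ innerCut X
  · have hcut : U.IsAdditiveCut (innerCut X) := ⟨isCut_innerCut X, hadd⟩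
    rcases hU.innerCut_eq_or_exists_cover hX hinf with ⟨a, hanti, haX, ha⟩ | ⟨b, e, he, hXb⟩
    · exact (hU.innerCut_dichotomy_of_eq hX hinf hanti haX ha).imp_right (⟨hcut, ·⟩)
    · exact (hU.innerCut_dichotomy_of_cover hX hinf hcut he hXb).imp_right (⟨hcut, ·⟩)
  · push Not at hadd
    obtain ⟨x, hx, y, hy, hxy⟩ := hadd
    exact .inl ⟨x + y, hU.isInfinitelyLarge_of_notMem_innerCut hinf hxy,
      hU.cdLe_of_mem_innerCut (max_rec' (· ∈ innerCut X) hx hy) (isCD_divNat _)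
        (divNat_add_subset_Iic_max x y),
      hU.cdLe_mulNat_of_notMem_innerCut hX hxy⟩

lemma CountablySaturated.existsUnique_of_cdEquiv (hU : U.CountablySaturated) (hX : X.Infinite)
    {C : Set (U.Hyper ℕ)} (hadd : U.IsAdditiveCut C) (hBorel : U.IsBorel C)
    (hCX : U.CDEquiv C X) :
    ∃! C : Set (U.Hyper ℕ), (U.IsAdditiveCut C ∧ U.IsBorel C) ∧ U.CDEquiv C X :=
  ⟨C, ⟨⟨hadd, hBorel⟩, hCX⟩, fun _ h => h.1.1.eq_of_cdEquiv hU hadd hX h.2 hCX⟩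

end InnerCut

end NonstandardUniverse

theorem mainTheorem5 (U : NonstandardUniverse.{u}) (hU : U.CountablySaturated)
    (X : Set (U.Hyper ℕ)) (hX : U.IsCD X) (hinf : X.Infinite) :
    (∃! C : Set (U.Hyper ℕ), (U.IsAdditiveCut C ∧ U.IsBorel C) ∧ U.CDEquiv C X) ∨
    (∃ c : U.Hyper ℕ, U.IsInfinitelyLarge c ∧
      U.CDLt (U.divNat c) X ∧ U.CDLt X (U.mulNat c)) := by
  rcases hU.innerCut_dichotomy hX hinf with ⟨c, hc, hcX, hXc⟩ | ⟨hadd, hBorel, hequiv⟩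
  · by_cases hXdiv : U.CDLe X (U.divNat c)
    · exact .inl (hU.existsUnique_of_cdEquiv hinf (NonstandardUniverse.isAdditiveCut_divNat c)
        (NonstandardUniverse.isBorel_divNat c) ⟨hcX, hXdiv⟩)
    by_cases hmulX : U.CDLe (U.mulNat c) X
    · exact .inl (hU.existsUnique_of_cdEquiv hinf (NonstandardUniverse.isAdditiveCut_mulNat c)
        (NonstandardUniverse.isBorel_mulNat c) ⟨hmulX, hXc⟩)
    exact .inr ⟨c, hc, ⟨hcX, hXdiv⟩, ⟨hXc, hmulX⟩⟩
  · exact .inl (hU.existsUnique_of_cdEquiv hinf hadd hBorel hequiv)
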